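/- Let $d\ge 1$ and let $M_d(\mathbb C)$ be the algebra of $d\times d$ complex matrices; a state is a positive semidefinite matrix of unit trace, and it is faithful if it is positive definite. Let $H\in M_d(\mathbb C)$ be selfadjoint, let $(L_j)_{j\in I}$ be a finite family in $M_d(\mathbb C)$, and consider the GKLS generator $$\mathcal L(x)=-\mathrm i[H,x]+\sum_{j\in I}\Big(L_j^*xL_j-\tfrac12\{L_j^*L_j,x\}\Big),\qquad x\in M_d(\mathbb C).$$ For a linear map $\eta$ on $M_d(\mathbb C)$ let $\eta^*$ be its dual, $\mathrm{tr}(x\,\eta(y))=\mathrm{tr}(\eta^*(x)y)$. Assume that there is a unique faithful state $\sigma$ with $\mathcal L^*(\sigma)=0$. Equip $M_d(\mathbb C)$ with the KMS inner product $\langle x,y\rangle=\mathrm{tr}(\sigma^{1/2}x^*\sigma^{1/2}y)$; write $\|\cdot\|_2$ for the norm it induces, and also for the corresponding operator norm of linear maps on $M_d(\mathbb C)$, $\eta^\dagger$ for the KMS-adjoint of $\eta$, and $\Re(\eta)=(\eta+\eta^\dagger)/2$. Put $\mathcal J_j(x)=L_j^*xL_j$, $G=\mathrm iH-\frac12\sum_{j\in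 I}L_j^*L_j$ and $e^{s\mathcal L_0}(x)=e^{sG^*}xe^{sG}$. For a state $\rho$ and $t\ge 0$, let $\mathbb P_\rho$ be the probability measure on the set $\Omega_t$ of detection records $(t_1,i_1,\dots,t_k,i_k)$, where $k\ge 0$, $0\le t_1\le\dots\le t_k\le t$ and $i_1,\dots,i_k\in I$, whose density is $$\mathrm{tr}\big(e^{(t-t_k)\mathcal L_0^*}\mathcal J_{i_k}^*e^{(t_k-t_{k-1})\mathcal L_0^*}\cdots\mathcal J_{i_1}^*e^{t_1\mathcal L_0^*}(\rho)\big)$$ (for $k=0$: $\mathrm{tr}(e^{t\mathcal L_0^*}(\rho))$) with respect to the measure that gives mass $1$ to the empty record and, for each $k\ge 1$ and each word $(i_1,\dots,i_k)$, is Lebesgue measure in $(t_1,\dots,t_k)$. For $i\in I$ let $N_i(t)$ be the number of indices $l$ with $i_l=i$. Fix $i\in I$ and set $\mathcal A=\Re(\mathcal L)$ and $\mathcal B=\Re(\mathcal J_i)$. Assume that $\mathcal A$ generates an irreducible quantum Markov semigroup, i.e. $e^{s\mathcal A}$ is completely positive and unital for every $s\ge 0$ and there is a unique faithful state $\tau$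 with $\mathcal A^*(\tau)=0$. Let $\varepsilon$ be the spectral gap of $\mathcal A$, i.e. the smallest $\lambda>0$ such that $-\lambda$ is an eigenvalue of $\mathcal A$ (if $d=1$ there is no such $\lambda$, and $\varepsilon=+\infty$, $1/\varepsilon=0$). Let $$m=\mathrm{tr}(L_i^*L_i\sigma),\qquad \alpha=\|\mathcal B\|_2,\qquad b=\|\mathcal B(\mathbf 1)\|_2,\qquad N_\rho=\|\sigma^{-1/2}\rho\,\sigma^{-1/2}\|_2 .$$ Then for every state $\rho$, every $t\ge 0$ and every $\gamma>0$ (with $N_i(t)/t$ read as $0$ if $t=0$), $$\mathbb P_\rho\Big(\frac{N_i(t)}{t}-m\ge\gamma\Big)\le N_\rho\exp\left(-\frac{t\,\gamma^2}{2\left(m+\frac{2b^2}{\varepsilon}+\max\left\{\frac{5\alpha}{\varepsilon},\frac52\right\}\gamma\right)}\right).$$ -/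

import Mathlib

open MeasureTheory
open scoped Matrix ComplexOrder

noncomputable section

namespace QuantumCounting

/-- The algebra `M_d(ℂ)` of `d × d` complex matrices. -/
abbrev Mat (d : ℕ) : Type := Matrix (Fin d) (Fin d) ℂ

/-- A state: a positive semidefinite matrix with unit trace. -/
def IsState {d : ℕ} (ρ : Mat d) : Prop := ρ.PosSemidef ∧ ρ.trace = 1

/-- A faithful state: a positive definite matrix with unit trace. -/
def IsFaithfulState {d : ℕ} (ρ : Mat d) : Prop := ρ.PosDef ∧ ρ.trace = 1

/-! ### Maps on the matrix algebra -/

/-- The dual `η^*` of a linear map `η` with respect to the trace pairing, i.e. the linear map with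
`tr (η^*(x) y) = tr (x η(y))` for all `x, y` (see `trace_traceDual_mul`). Its `(a, b)` entry at `x`
is `tr (x η(E_{ba}))`, where `E_{ba}` is a matrix unit. -/
def traceDual {d : ℕ} (η : Mat d →ₗ[ℂ] Mat d) : Mat d →ₗ[ℂ] Mat d where
  toFun x := Matrix.of fun a b => (x * η (Matrix.single b a 1)).trace
  map_add' x y := by
    ext a b
    simp [add_mul, Matrix.trace_add]
  map_smul' c x := by
    ext a b
    simp [Matrix.trace_smul]

theorem trace_traceDual_mul {d : ℕ} (η : Mat d →ₗ[ℂ] Mat d) (x y : Mat d) :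
    (traceDual η x * y).trace = (x * η y).trace := by
  have hy : y = ∑ b, ∑ a, y b a • Matrix.single b a (1 : ℂ) := by
    conv_lhs => rw [Matrix.matrix_eq_sum_single y]
    simp [Matrix.smul_single]
  conv_rhs => rw [hy]
  simp only [map_sum, map_smul, Finset.mul_sum, Matrix.trace_sum, mul_smul_comm,
    Matrix.trace_smul, smul_eq_mul]
  simp only [Matrix.trace, Matrix.diag_apply, Matrix.mul_apply, traceDual, LinearMap.coe_mk,
    AddHom.coe_mk, Matrix.of_apply]
  rw [Finset.sum_comm]
  exact Finset.sum_congr rfl fun b _ => Finset.sum_congr rfl fun a _ => mul_comm _ _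

/-- Complete positivity, through a finite Kraus representation `η(x) = ∑ⱼ Wⱼ^* x Wⱼ`. -/
def IsCompletelyPositive {d : ℕ} (η : Mat d → Mat d) : Prop :=
  ∃ (n : ℕ) (W : Fin n → Mat d), ∀ x, η x = ∑ j, (W j)ᴴ * x * W j

/-- A quantum channel in the Heisenberg picture: completely positive and unital. -/
def IsQuantumChannel {d : ℕ} (η : Mat d → Mat d) : Prop :=
  IsCompletelyPositive η ∧ η 1 = 1

/-- The exponential `e^{tK}` of a linear map `K` on `M_d(ℂ)`, by its power series. -/
def expMap {d : ℕ} (K : Mat d →ₗ[ℂ] Mat d) (t : ℝ) (x : Mat d) : Mat d :=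
  ∑' n : ℕ, ((t : ℂ) ^ n / (n.factorial : ℂ)) • (K ^ n) x

/-- `K` generates a quantum Markov semigroup: `e^{tK}` is a quantum channel for every `t ≥ 0`. -/
def GeneratesQMS {d : ℕ} (K : Mat d →ₗ[ℂ] Mat d) : Prop :=
  ∀ t : ℝ, 0 ≤ t → IsQuantumChannel (expMap K t)

/-- `σ` is the unique faithful state with `K^*(σ) = 0`. -/
def IsUniqueFaithfulInvariantState {d : ℕ} (K : Mat d →ₗ[ℂ] Mat d) (σ : Mat d) : Prop :=
  IsFaithfulState σ ∧ traceDual K σ = 0 ∧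
    ∀ τ : Mat d, IsFaithfulState τ → traceDual K τ = 0 → τ = σ

/-- `K` generates an irreducible quantum Markov semigroup: it generates a quantum Markov semigroup
which has a unique faithful invariant state. -/
def GeneratesIrreducibleQMS {d : ℕ} (K : Mat d →ₗ[ℂ] Mat d) : Prop :=
  GeneratesQMS K ∧ ∃ σ : Mat d, IsUniqueFaithfulInvariantState K σ

/-! ### The KMS inner product -/

/-- The real power `σ^s` of a positive definite matrix, by functional calculus. -/
def mpow {d : ℕ} (σ : Mat d) (s : ℝ) : Mat d := cfc (fun x : ℝ => x ^ s) σ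

theorem mpow_mul {d : ℕ} {σ : Mat d} (hσ : σ.PosDef) (s r : ℝ) :
    mpow σ s * mpow σ r = mpow σ (s + r) := by
  have hs : ∀ x ∈ spectrum ℝ σ, 0 < x := by
    intro x hx
    rw [hσ.isHermitian.spectrum_real_eq_range_eigenvalues] at hx
    obtain ⟨j, rfl⟩ := hx
    exact hσ.eigenvalues_pos j
  have hc : ∀ f : ℝ → ℝ, ContinuousOn f (spectrum ℝ σ) := fun f => by
    rw [hσ.isHermitian.spectrum_real_eq_range_eigenvalues]
    exact (Set.finite_range _).continuousOn f
  unfold mpow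
  rw [← cfc_mul _ _ σ (hc _) (hc _)]
  exact cfc_congr fun x hx => (Real.rpow_add (hs x hx) s r).symm

theorem mpow_zero {d : ℕ} {σ : Mat d} (hσ : σ.PosDef) : mpow σ 0 = 1 := by
  unfold mpow
  simp only [Real.rpow_zero]
  exact cfc_const_one ℝ σ hσ.isHermitian

theorem mpow_one {d : ℕ} {σ : Mat d} (hσ : σ.PosDef) : mpow σ 1 = σ := by
  unfold mpow
  simp only [Real.rpow_one]
  exact cfc_id' ℝ σ hσ.isHermitian

theorem mpow_herm {d : ℕ} {σ : Mat d} (s : ℝ) :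
    (mpow σ s)ᴴ = mpow σ s := by
  exact (cfc_predicate (R := ℝ) (fun x : ℝ => x ^ s) σ)

/-- The KMS inner product `⟨x, y⟩ = tr (σ^{1/2} x^* σ^{1/2} y)`. -/
def kmsInner {d : ℕ} (σ x y : Mat d) : ℂ :=
  (mpow σ (1 / 2) * xᴴ * mpow σ (1 / 2) * y).trace

/-- The KMS norm `‖x‖₂ = ⟨x, x⟩^{1/2}`. -/
def kmsNorm {d : ℕ} (σ x : Mat d) : ℝ := Real.sqrt (kmsInner σ x x).re

/-- The operator norm `‖η‖₂` induced by the KMS norm. -/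
def kmsOpNorm {d : ℕ} (σ : Mat d) (η : Mat d →ₗ[ℂ] Mat d) : ℝ :=
  sInf {c : ℝ | 0 ≤ c ∧ ∀ x, kmsNorm σ (η x) ≤ c * kmsNorm σ x}

/-- The map `Γ_σ^s : x ↦ σ^s x σ^s`. -/
def Gam {d : ℕ} (σ : Mat d) (s : ℝ) : Mat d →ₗ[ℂ] Mat d :=
  LinearMap.mulLeftRight ℂ (mpow σ s, mpow σ s)

/-- The adjoint `η^† = Γ_σ^{-1/2} ∘ η^* ∘ Γ_σ^{1/2}` of a map `η` with `η(x^*) = η(x)^*` (such as a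
GKLS generator or a completely positive map) for the KMS inner product; see
`kmsInner_kmsAdjoint`. -/
def kmsAdjoint {d : ℕ} (σ : Mat d) (η : Mat d →ₗ[ℂ] Mat d) : Mat d →ₗ[ℂ] Mat d :=
  Gam σ (-(1 / 2)) ∘ₗ traceDual η ∘ₗ Gam σ (1 / 2)

theorem traceDual_herm {d : ℕ} {η : Mat d →ₗ[ℂ] Mat d} (hη : ∀ x, η xᴴ = (η x)ᴴ)
    (x : Mat d) :
    traceDual η xᴴ = (traceDual η x)ᴴ := by
  ext a b
  have : (Matrix.single b a (1:ℂ))= (Matrix.single a b (1:ℂ))ᴴ := by simp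
  simp only [traceDual, LinearMap.coe_mk, AddHom.coe_mk, Matrix.of_apply,
    Matrix.conjTranspose_apply]
  rw [this, hη, ← Matrix.conjTranspose_mul, Matrix.trace_conjTranspose, Matrix.trace_mul_comm]

theorem kmsInner_kmsAdjoint {d : ℕ} {σ : Mat d} (hσ : σ.PosDef) {η : Mat d →ₗ[ℂ] Mat d}
    (hη : ∀ x, η xᴴ = (η x)ᴴ) (x y : Mat d) :
    kmsInner σ (kmsAdjoint σ η x) y = kmsInner σ x (η y) := by
  have h1 : mpow σ (1/2) * mpow σ (-(1/2)) = 1 := by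
    rw [mpow_mul hσ]; norm_num; exact mpow_zero hσ
  have h2 : mpow σ (-(1/2)) * mpow σ (1/2) = 1 := by
    rw [mpow_mul hσ]; norm_num; exact mpow_zero hσ
  have key : mpow σ (1 / 2) * (kmsAdjoint σ η x)ᴴ * mpow σ (1 / 2)
      = traceDual η (mpow σ (1/2) * xᴴ * mpow σ (1/2)) := by
    simp only [kmsAdjoint, Gam, LinearMap.comp_apply, LinearMap.mulLeftRight_apply,
      Matrix.conjTranspose_mul, mpow_herm, ← traceDual_herm hη]
    rw [← mul_assoc, ← mul_assoc, h1, mul_assoc, h2]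
    simp [mul_assoc]
  unfold kmsInner
  rw [key, trace_traceDual_mul]

/-- The real part `Re(η) = (η + η^†) / 2`. -/
def kmsRe {d : ℕ} (σ : Mat d) (η : Mat d →ₗ[ℂ] Mat d) : Mat d →ₗ[ℂ] Mat d :=
  (1 / 2 : ℂ) • (η + kmsAdjoint σ η)

/-- The spectral gap of the (KMS-selfadjoint) generator `K` of an irreducible quantum Markov
semigroup: the distance of its simple largest eigenvalue `0` to the other eigenvalues, all of which
are negative. If `d = 1` there is no other eigenvalue and the value is `sInf ∅ = 0`; as `x / 0 = 0`,
the terms `x / ε` below then vanish, which is the usual convention of an infinite gap. -/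
def spectralGap {d : ℕ} (K : Mat d →ₗ[ℂ] Mat d) : ℝ :=
  sInf {l : ℝ | 0 < l ∧ Module.End.HasEigenvalue K (-(l : ℂ))}

/-! ### The generator and the counting process -/

/-- The map `J(x) = V^* x V`. -/
def jumpMap {d : ℕ} (V : Mat d) : Mat d →ₗ[ℂ] Mat d := LinearMap.mulLeftRight ℂ (Vᴴ, V)

/-- The GKLS generator `ℒ(x) = -i[H,x] + ∑ⱼ (Lⱼ^* x Lⱼ - ½ {Lⱼ^* Lⱼ, x})`. -/
def gkls {d : ℕ} {ι : Type*} [Fintype ι] (H : Mat d) (L : ι → Mat d) : Mat d →ₗ[ℂ] Mat d :=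
  -(Complex.I • (LinearMap.mulLeft ℂ H - LinearMap.mulRight ℂ H)) +
    ∑ j, (jumpMap (L j) -
      (1 / 2 : ℂ) • (LinearMap.mulLeft ℂ ((L j)ᴴ * L j) + LinearMap.mulRight ℂ ((L j)ᴴ * L j)))

theorem gkls_apply {d : ℕ} {ι : Type*} [Fintype ι] (H : Mat d) (L : ι → Mat d) (x : Mat d) :
    gkls H L x = -(Complex.I • (H * x - x * H)) +
      ∑ j, ((L j)ᴴ * x * L j - (1 / 2 : ℂ) • ((L j)ᴴ * L j * x + x * ((L j)ᴴ * L j))) := by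
  simp [gkls, jumpMap, LinearMap.sum_apply, Matrix.mul_assoc]

/-- The matrix `G = iH - ½ ∑ⱼ Lⱼ^* Lⱼ`. -/
def effG {d : ℕ} {ι : Type*} [Fintype ι] (H : Mat d) (L : ι → Mat d) : Mat d :=
  Complex.I • H - (1 / 2 : ℂ) • ∑ j, (L j)ᴴ * L j

/-- Evolution of an unnormalized state between detections: the dual `ρ ↦ e^{sG} ρ e^{sG^*}` of
`x ↦ e^{sG^*} x e^{sG}`. -/
def noJump {d : ℕ} {ι : Type*} [Fintype ι] (H : Mat d) (L : ι → Mat d) (s : ℝ)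
    (ρ : Mat d) : Mat d :=
  NormedSpace.exp ((s : ℂ) • effG H L) * ρ * NormedSpace.exp ((s : ℂ) • (effG H L)ᴴ)

/-- The unnormalized state at time `t` after clicks of the detectors `i₁, …, i_k` at the times
`t₁, …, t_k`:
`e^{(t-t_k)ℒ₀^*} J_{i_k}^* e^{(t_k-t_{k-1})ℒ₀^*} ⋯ J_{i_1}^* e^{t_1 ℒ₀^*}(ρ)`,
where `J_i^*(ρ) = L_i ρ L_i^*`. -/
def trajectory {d : ℕ} {ι : Type*} [Fintype ι] (H : Mat d) (L : ι → Mat d) (ρ : Mat d) :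
    (k : ℕ) → (Fin k → ι) → (Fin k → ℝ) → ℝ → Mat d
  | 0, _, _, t => noJump H L t ρ
  | k + 1, w, τ, t =>
      noJump H L (t - τ (Fin.last k))
        (L (w (Fin.last k)) *
          trajectory H L ρ k (fun l => w l.castSucc) (fun l => τ l.castSucc) (τ (Fin.last k)) *
          (L (w (Fin.last k)))ᴴ)

/-- Ordered click times `0 ≤ t₁ ≤ ⋯ ≤ t_k ≤ t`. -/
abbrev ClickTimes (t : ℝ) (k : ℕ) : Type :=
  {τ : Fin k → ℝ // Monotone τ ∧ ∀ l, τ l ∈ Set.Icc 0 t}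

/-- The space `Ω_t` of detection records up to time `t`: a number `k` of clicks, a word
`(i₁, …, i_k)` of detectors and ordered click times. It carries the σ-algebra of the disjoint
union. -/
abbrev Record (ι : Type*) (t : ℝ) : Type _ :=
  (w : (k : ℕ) × (Fin k → ι)) × ClickTimes t w.1

/-- The reference measure on `Ω_t`: Lebesgue measure on the click times for each word of detectors,
and a unit mass at the empty record. -/
def refMeasure (ι : Type*) (t : ℝ) : Measure (Record ι t) :=
  Measure.sum fun w : (k : ℕ) × (Fin k → ι) =>
    ((volume : Measure (Fin w.1 → ℝ)).comap (Subtype.val : ClickTimes t w.1 → _)).map (Sigma.mk w)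

/-- The law `ℙ_ρ` of the detection record up to time `t`, with density
`tr (e^{(t-t_k)ℒ₀^*} J_{i_k}^* ⋯ J_{i_1}^* e^{t_1 ℒ₀^*}(ρ))` with respect to the reference
measure. -/
def recordLaw {d : ℕ} {ι : Type*} [Fintype ι] (H : Mat d) (L : ι → Mat d) (ρ : Mat d)
    (t : ℝ) : Measure (Record ι t) :=
  (refMeasure ι t).withDensity fun ω =>
    ENNReal.ofReal (trajectory H L ρ ω.1.1 ω.1.2 ω.2.1 t).trace.re

/-- The number `N_i(t)` of clicks of the detector `i` in a record up to time `t`. -/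
def clickCount {ι : Type*} [DecidableEq ι] (i : ι) {t : ℝ} (ω : Record ι t) : ℕ :=
  ∑ l, if ω.1.2 l = i then 1 else 0

end QuantumCounting

end

open QuantumCounting

/-!
Counting the clicks of detector `i` with a factor `e^u` each replaces the generator `ℒ` by the
tilted generator `ℒ + r 𝒥ᵢ`, `r = e^u - 1`, and the exponential moment `𝔼[e^{u Nᵢ(t)}]` is the trace
of the solution of the dual tilted master equation started at `ρ`. In the KMS inner product
`tr y = ⟨1, σ^{-1/2} y σ^{-1/2}⟩`, so by Cauchy–Schwarz the moment is at most `N_ρ e^{Λ t}`, where `Λ`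
bounds the numerical range of the tilted generator, that is, of its real part `A + r B`.

*Numerical range.* `A` is KMS-selfadjoint, its kernel is spanned by `1` (`exists_eq_smul_one`) and
its other eigenvalues are at most `-ε` (`eigenvalue_nonpos`). Splitting `x = c 1 + y` with `y ⊥ 1`,
and using `⟨1, B 1⟩ = m`, `‖B 1‖ = b`, `‖B‖ = α`, gives `Λ = r m + r² b² / (ε - r α)`
(`re_inner_perturbation_le`). The tilt `u = γ / D`, with `D = m + 2b²/ε + max (5α/ε) (5/2) γ`, then
turns the Chernoff exponent into the stated rate (`exists_tilt`).

*Exponential moment.* Neither positivity nor existence of the tilted semigroup is needed. The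
records with exactly `k` clicks contribute `clickPart k`, defined by a Duhamel recursion, and the sum
over `k ≤ n` solves the tilted master equation up to a positive loss term
(`hasDerivAt_truncatedState`). Since the trace of a product of two positive semidefinite matrices is
nonnegative, the loss can only decrease the KMS norm, and the energy estimate
`trace_truncatedState_le` holds for every `n`. Tonelli's theorem, integrating out the last click
first, identifies `clickPart` with the integral over records (`lintegral_weightedTrajectory`), and
monotone convergence in `n` gives the bound on the moment.
-/

open MeasureTheory
open scoped Matrix ComplexOrder

noncomputable section

namespace QuantumCounting

/-! ### Perturbation of a spectral gap -/

section Gap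

open Module.End

variable {E : Type*} [NormedAddCommGroup E] [InnerProductSpace ℂ E]

section FiniteDimensional

variable [FiniteDimensional ℂ E]

theorem re_inner_apply_eq_sum {T : E →ₗ[ℂ] E} (hT : T.IsSymmetric) (x : E) :
    (inner ℂ x (T x)).re = ∑ j, hT.eigenvalues rfl j *
      ‖inner ℂ (hT.eigenvectorBasis rfl j) x‖ ^ 2 := by
  rw [← (hT.eigenvectorBasis rfl).sum_inner_mul_inner x (T x), Complex.re_sum]
  refine Finset.sum_congr rfl fun j _ => ?_
  have h := hT.eigenvectorBasis_apply_self_apply rfl x j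
  rw [OrthonormalBasis.repr_apply_apply, OrthonormalBasis.repr_apply_apply] at h
  rw [h, mul_left_comm, ← inner_conj_symm x, Complex.conj_mul', ← Complex.ofReal_pow]
  exact Complex.re_ofReal_mul _ _

theorem inner_eigenvectorBasis_eq_zero {T : E →ₗ[ℂ] E} (hT : T.IsSymmetric) {e : E}
    (hker : ∀ x, T x = 0 → ∃ c : ℂ, x = c • e) {x : E} (hx : inner ℂ e x = 0)
    {j : Fin (Module.finrank ℂ E)} (hj : hT.eigenvalues rfl j = 0) :
    inner ℂ (hT.eigenvectorBasis rfl j) x = 0 := by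
  have h := hT.apply_eigenvectorBasis rfl j
  rw [hj, RCLike.ofReal_zero, zero_smul] at h
  obtain ⟨c, hc⟩ := hker _ h
  rw [hc, inner_smul_left, hx, mul_zero]

theorem neg_eigenvalues_mem {T : E →ₗ[ℂ] E} (hT : T.IsSymmetric)
    (hneg : ∀ μ : ℝ, HasEigenvalue T (μ : ℂ) → μ ≤ 0) {j : Fin (Module.finrank ℂ E)}
    (hj : hT.eigenvalues rfl j ≠ 0) :
    -hT.eigenvalues rfl j ∈ {l : ℝ | 0 < l ∧ HasEigenvalue T (-(l : ℂ))} := by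
  have h := hT.hasEigenvalue_eigenvalues rfl j
  refine ⟨neg_pos.2 (lt_of_le_of_ne (hneg _ h) hj), ?_⟩
  simpa using h

/-- On the orthogonal complement of the kernel, a negative semidefinite operator is bounded above
by minus its smallest nonzero eigenvalue in absolute value. -/
theorem re_inner_apply_le_neg_gap {T : E →ₗ[ℂ] E} (hT : T.IsSymmetric)
    (hneg : ∀ μ : ℝ, HasEigenvalue T (μ : ℂ) → μ ≤ 0) {e : E}
    (hker : ∀ x, T x = 0 → ∃ c : ℂ, x = c • e) {x : E} (hx : inner ℂ e x = 0) :
    (inner ℂ x (T x)).re ≤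
      -sInf {l : ℝ | 0 < l ∧ HasEigenvalue T (-(l : ℂ))} * ‖x‖ ^ 2 := by
  rw [re_inner_apply_eq_sum hT, ← (hT.eigenvectorBasis rfl).sum_sq_norm_inner_right x,
    Finset.mul_sum]
  refine Finset.sum_le_sum fun j _ => ?_
  by_cases hj : hT.eigenvalues rfl j = 0
  · rw [inner_eigenvectorBasis_eq_zero hT hker hx hj]
    simp
  · have : sInf {l : ℝ | 0 < l ∧ HasEigenvalue T (-(l : ℂ))} ≤ -hT.eigenvalues rfl j :=
      csInf_le ⟨0, fun l hl => hl.1.le⟩ (neg_eigenvalues_mem hT hneg hj)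
    exact mul_le_mul_of_nonneg_right (by linarith) (sq_nonneg _)

/-- Either the gap is positive, or the kernel is the whole space (and then the gap is the junk
value `sInf ∅`). -/
theorem gap_pos_or_eq_zero {T : E →ₗ[ℂ] E} (hT : T.IsSymmetric)
    (hneg : ∀ μ : ℝ, HasEigenvalue T (μ : ℂ) → μ ≤ 0) {e : E}
    (hker : ∀ x, T x = 0 → ∃ c : ℂ, x = c • e) :
    0 < sInf {l : ℝ | 0 < l ∧ HasEigenvalue T (-(l : ℂ))} ∨ ∀ x : E, inner ℂ e x = 0 → x = 0 := by
  rcases Set.eq_empty_or_nonempty {l : ℝ | 0 < l ∧ HasEigenvalue T (-(l : ℂ))} with h0 | hne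
  · refine Or.inr fun x hx => ?_
    refine InnerProductSpace.ext_inner_left_basis (𝕜 := ℂ)
      (hT.eigenvectorBasis rfl).toBasis fun j => ?_
    rw [OrthonormalBasis.coe_toBasis, inner_zero_right]
    refine inner_eigenvectorBasis_eq_zero hT hker hx ?_
    by_contra hj
    have := neg_eigenvalues_mem hT hneg hj
    rw [h0] at this
    exact this
  · refine Or.inl (hne.csInf_mem ?_).1
    have hfin : Set.Finite {μ : ℂ | HasEigenvalue T μ} := Module.End.finite_hasEigenvalue T
    have hinj : Function.Injective fun l : ℝ => -(l : ℂ) := fun a b h => by simpa using h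
    exact (hfin.preimage hinj.injOn).subset fun l hl => hl.2

end FiniteDimensional

/-- The numerical range of `A + r B`, where `A ≤ 0` has kernel spanned by the unit vector `e` and
spectral gap `ε`: splitting `x = c e + y` leaves a quadratic form in `(|c|, ‖y‖)` whose value is at
most `r ⟨e, B e⟩ + δ` as soon as `δ ≥ r² ‖B e‖² / (ε - r α)`. -/
theorem re_inner_perturbation_le {A B : E →ₗ[ℂ] E} (hA : A.IsSymmetric) (hB : B.IsSymmetric)
    {e : E} (he : ‖e‖ = 1) (hAe : A e = 0) {ε α r δ : ℝ}
    (hgap : ∀ y, inner ℂ e y = 0 → (inner ℂ y (A y)).re ≤ -ε * ‖y‖ ^ 2)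
    (hα : ∀ y, ‖B y‖ ≤ α * ‖y‖) (hr : 0 ≤ r) (hδ : 0 ≤ δ) (hm : 0 ≤ (inner ℂ e (B e)).re)
    (h : (∀ y, inner ℂ e y = 0 → y = 0) ∨
      (r * α < ε ∧ r ^ 2 * ‖B e‖ ^ 2 ≤ δ * (ε - r * α))) (x : E) :
    (inner ℂ x ((A + (r : ℂ) • B) x)).re ≤ (r * (inner ℂ e (B e)).re + δ) * ‖x‖ ^ 2 := by
  set c : ℂ := inner ℂ e x with hc
  set y : E := x - c • e with hy
  have hee : inner ℂ e e = (1 : ℂ) := by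
    rw [inner_self_eq_norm_sq_to_K, he]; simp
  have hey : inner ℂ e y = (0 : ℂ) := by
    rw [hy, inner_sub_right, inner_smul_right, hee, ← hc]; simp
  have hye : inner ℂ y e = (0 : ℂ) := by
    rw [← inner_conj_symm, hey]; simp
  have hx : x = c • e + y := by rw [hy]; abel
  have hnorm : ‖x‖ ^ 2 = ‖c‖ ^ 2 + ‖y‖ ^ 2 := by
    rw [hx, sq, norm_add_sq_eq_norm_sq_add_norm_sq_of_inner_eq_zero _ _
      (by rw [inner_smul_left, hey, mul_zero]), norm_smul, he]
    ring
  have hAx : (inner ℂ x (A x)).re = (inner ℂ y (A y)).re := by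
    have h1 : inner ℂ e (A y) = (0 : ℂ) := by rw [← hA, hAe, inner_zero_left]
    rw [hx, map_add, map_smul, hAe, smul_zero, zero_add, inner_add_left, inner_smul_left, h1]
    simp
  have hBx : (inner ℂ x (B x)).re = ‖c‖ ^ 2 * (inner ℂ e (B e)).re
      + 2 * (c * inner ℂ y (B e)).re + (inner ℂ y (B y)).re := by
    have h1 : inner ℂ e (B y) = (starRingEnd ℂ) (inner ℂ y (B e)) := by
      rw [← hB, inner_conj_symm]
    have h2 : inner ℂ x (B x) = (starRingEnd ℂ c * c) * inner ℂ e (B e)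
        + ((starRingEnd ℂ) (c * inner ℂ y (B e)) + c * inner ℂ y (B e)) + inner ℂ y (B y) := by
      rw [hx, map_add, map_smul, inner_add_left, inner_add_right, inner_add_right,
        inner_smul_left, inner_smul_left, inner_smul_right, inner_smul_right, h1, map_mul]
      ring
    rw [h2, Complex.conj_mul']
    simp only [Complex.add_re, Complex.conj_re]
    rw [← Complex.ofReal_pow, Complex.re_ofReal_mul]
    ring
  have hlin : (c * inner ℂ y (B e)).re ≤ ‖c‖ * (‖y‖ * ‖B e‖) := by
    refine (Complex.re_le_norm _).trans ?_
    rw [norm_mul]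
    exact mul_le_mul_of_nonneg_left (norm_inner_le_norm _ _) (norm_nonneg _)
  have hquad : (inner ℂ y (B y)).re ≤ α * ‖y‖ ^ 2 := by
    refine (Complex.re_le_norm _).trans ((norm_inner_le_norm _ _).trans ?_)
    have := mul_le_mul_of_nonneg_left (hα y) (norm_nonneg y)
    linarith
  have htot : (inner ℂ x ((A + (r : ℂ) • B) x)).re
      = (inner ℂ y (A y)).re + r * (inner ℂ x (B x)).re := by
    rw [LinearMap.add_apply, LinearMap.smul_apply, inner_add_right, inner_smul_right,
      Complex.add_re, Complex.re_ofReal_mul, hAx]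
  rw [htot, hBx, hnorm]
  have hA' := hgap y hey
  set M := (inner ℂ e (B e)).re
  set P := ‖c‖
  set s := ‖y‖ with hs
  set b := ‖B e‖
  have hP : 0 ≤ P := norm_nonneg _
  have hs0 : 0 ≤ s := norm_nonneg _
  have key : 2 * r * (P * (s * b)) ≤ δ * P ^ 2 + (ε - r * α) * s ^ 2 := by
    rcases h with h | ⟨h1, h2⟩
    · have : s = 0 := by rw [hs, h y hey, norm_zero]
      rw [this]
      have := mul_nonneg hδ (sq_nonneg P)
      simpa using this
    · -- complete the square after multiplying by the positive number `ε - r α`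
      have hq : 0 < ε - r * α := by linarith
      refine le_of_mul_le_mul_left ?_ hq
      nlinarith [sq_nonneg (r * b * P - (ε - r * α) * s),
        mul_le_mul_of_nonneg_right h2 (sq_nonneg P)]
  have h3 := mul_le_mul_of_nonneg_left hlin hr
  have h4 := mul_le_mul_of_nonneg_left hquad hr
  have h5 := mul_nonneg (mul_nonneg hr hm) (sq_nonneg s)
  have h6 := mul_nonneg hδ (sq_nonneg s)
  nlinarith

end Gap

/-! ### The choice of the tilt -/

theorem exp_sub_one_mul_le {u : ℝ} (hu : 0 ≤ u) : (Real.exp u - 1) * (1 - u / 2) ≤ u := by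
  have hmono : MonotoneOn (fun u : ℝ => 2 + u - Real.exp u * (2 - u)) (Set.Ici 0) := by
    refine monotoneOn_of_deriv_nonneg (convex_Ici 0) (by fun_prop) (by fun_prop) fun v _ => ?_
    have hd : HasDerivAt (fun u : ℝ => 2 + u - Real.exp u * (2 - u))
        (1 - (Real.exp v * (2 - v) + Real.exp v * (-1))) v :=
      ((hasDerivAt_id v).const_add 2).sub
        ((Real.hasDerivAt_exp v).mul ((hasDerivAt_id v).const_sub 2))
    rw [hd.deriv]
    have h1 := mul_le_mul_of_nonneg_left (Real.add_one_le_exp (-v)) (Real.exp_pos v).le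
    rw [← Real.exp_add, add_neg_cancel, Real.exp_zero] at h1
    linarith
  have := hmono Set.self_mem_Ici (Set.mem_Ici.2 hu) hu
  simp only [add_zero, Real.exp_zero, sub_zero, one_mul, sub_self] at this
  linarith

set_option maxHeartbeats 400000 in
/-- The Bernstein choice `u = γ / D` of the tilting parameter, where `D` is half the denominator of
the rate. Write `a = α / ε` and `K = max (5a) (5/2)`. Then `K ≥ 1 + a`, which gives
`(1 - u/2)² - a u (1 - u/2) ≥ 1 - K u`, and `K u ≤ 1` gives `u ≤ 2/5` and `a u ≤ 1/5`, which keep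
`r a < 1` for `r = e^u - 1 ≤ u / (1 - u/2)`. -/
theorem exists_tilt {m b α ε γ : ℝ} (hm : 0 ≤ m) (hα : 0 ≤ α) (hε : 0 ≤ ε)
    (hγ : 0 < γ) :
    ∃ u δ : ℝ, 0 ≤ u ∧ 0 ≤ δ ∧
      (0 < ε → (Real.exp u - 1) * α < ε ∧
        (Real.exp u - 1) ^ 2 * b ^ 2 ≤ δ * (ε - (Real.exp u - 1) * α)) ∧
      (Real.exp u - 1) * m + δ - u * (m + γ) ≤
        -(γ ^ 2 / (2 * (m + 2 * b ^ 2 / ε + max (5 * α / ε) (5 / 2) * γ))) := by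
  set K := max (5 * α / ε) (5 / 2) with hK
  set β := b ^ 2 / ε with hβ
  have hK1 : 5 * (α / ε) ≤ K := by rw [← mul_div_assoc]; exact le_max_left _ _
  have hK2 : 5 / 2 ≤ K := le_max_right _ _
  have ha : 0 ≤ α / ε := div_nonneg hα hε
  have hβ0 : 0 ≤ β := div_nonneg (sq_nonneg b) hε
  rw [mul_div_assoc, ← hβ]
  set V := m + 2 * β with hV
  have hV0 : 0 ≤ V := by positivity
  set D := V + K * γ with hD
  have hKγ : 0 < K * γ := mul_pos (by linarith) hγ
  have hD0 : 0 < D := by linarith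
  set u := γ / D with hu
  have hu0 : 0 < u := div_pos hγ hD0
  have huD : u * D = γ := by rw [hu]; field_simp
  have hw : (1 - K * u) * D = V := by
    have : (1 - K * u) * D = D - K * (u * D) := by ring
    rw [this, huD, hD]; ring
  have hw0 : 0 ≤ 1 - K * u := by
    by_contra hcon
    have := mul_neg_of_neg_of_pos (not_le.1 hcon) hD0
    linarith
  have hu1 : u ≤ 2 / 5 := by nlinarith
  set r := Real.exp u - 1 with hr
  have hru : u ≤ r := by have := Real.add_one_le_exp u; rw [hr]; linarith
  have hr0 : 0 ≤ r := hu0.le.trans hru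
  have hrq : r * (1 - u / 2) ≤ u := exp_sub_one_mul_le hu0.le
  have hq : 4 / 5 ≤ 1 - u / 2 := by linarith
  set a := α / ε with ha'
  set q := 1 - u / 2 with hqdef
  have hqK : 1 - K * u ≤ q ^ 2 - u * a * q := by
    have h1 : u * a * q ≤ u * a * 1 :=
      mul_le_mul_of_nonneg_left (by linarith) (mul_nonneg hu0.le ha)
    have h2 : u * (1 + a) ≤ u * K := mul_le_mul_of_nonneg_left (by linarith) hu0.le
    nlinarith [sq_nonneg u]
  have hra : (1 - K * u) ≤ q ^ 2 * (1 - r * a) := by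
    have h1 : r * q * (a * q) ≤ u * (a * q) :=
      mul_le_mul_of_nonneg_right hrq (mul_nonneg ha (by linarith))
    nlinarith
  have hr2 : r ^ 2 * (1 - K * u) ≤ u ^ 2 * (1 - r * a) := by
    have hq2 : 0 < q ^ 2 := by positivity
    have h1 : (r * q) ^ 2 ≤ u ^ 2 := pow_le_pow_left₀ (mul_nonneg hr0 (by linarith)) hrq 2
    have h2 := mul_le_mul_of_nonneg_right h1 hw0
    have h3 := mul_le_mul_of_nonneg_left hra (sq_nonneg u)
    refine le_of_mul_le_mul_left ?_ hq2
    nlinarith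
  have hru2 : (r - u) * (1 - K * u) ≤ u ^ 2 / 2 := by
    have h1 : 1 - K * u ≤ q := by nlinarith
    have h2 := mul_le_mul_of_nonneg_left h1 (sub_nonneg.2 hru)
    nlinarith
  have hra1 : r * a < 1 := by
    by_contra! hcon
    have h1 := mul_le_mul_of_nonneg_right hrq ha
    have h2 := mul_le_mul_of_nonneg_left hK1 hu0.le
    have h3 : q ≤ r * a * q := le_mul_of_one_le_left (by linarith) hcon
    linarith
  have hrα : 0 < ε → r * α < ε ∧ r ^ 2 * b ^ 2 = r ^ 2 * β * ε ∧
      ε - r * α = (1 - r * a) * ε := by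
    intro hε
    have e1 : r * α = r * a * ε := by rw [ha']; field_simp
    have e2 : b ^ 2 = β * ε := by rw [hβ]; field_simp
    refine ⟨?_, ?_, ?_⟩
    · rw [e1]; exact mul_lt_of_lt_one_left hε hra1
    · rw [e2]; ring
    · rw [e1]; ring
  have hrate : γ ^ 2 / (2 * D) = u * γ / 2 := by rw [hu]; field_simp
  rw [hrate]
  rcases hV0.eq_or_lt with hV1 | hV1
  · -- no variance: `m = 0` and `b² / ε = 0`
    have hm0 : m = 0 := by linarith
    have hβ1 : β = 0 := by linarith
    refine ⟨u, 0, hu0.le, le_rfl, fun hε => ⟨(hrα hε).1, ?_⟩, ?_⟩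
    · rw [(hrα hε).2.1, hβ1]; simp
    · have := mul_pos hu0 hγ
      rw [hm0]; linarith
  · have hw1 : 0 < 1 - K * u := by
      refine lt_of_le_of_ne hw0 fun h0 => ?_
      rw [← h0, zero_mul] at hw
      linarith
    refine ⟨u, u ^ 2 * β / (1 - K * u), hu0.le, by positivity, fun hε => ⟨(hrα hε).1, ?_⟩, ?_⟩
    · rw [(hrα hε).2.1, (hrα hε).2.2, ← mul_assoc]
      refine mul_le_mul_of_nonneg_right ?_ hε.le
      rw [div_mul_eq_mul_div, le_div_iff₀ hw1]
      nlinarith [mul_le_mul_of_nonneg_right hr2 hβ0]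
    · have h1 : (r - u) * m ≤ u ^ 2 / 2 * m / (1 - K * u) := by
        rw [le_div_iff₀ hw1]
        nlinarith [mul_le_mul_of_nonneg_right hru2 hm]
      have h2 : u ^ 2 / 2 * m / (1 - K * u) + u ^ 2 * β / (1 - K * u) = u * γ / 2 := by
        rw [← add_div, div_eq_iff hw1.ne', ← huD]
        have : u ^ 2 / 2 * m + u ^ 2 * β = u ^ 2 / 2 * V := by rw [hV]; ring
        rw [this, ← hw]; ring
      linarith

/-! ### Positive semidefinite matrices and the trace pairing -/

section Trace

variable {d : ℕ}

open scoped Matrix.Norms.L2Operator MatrixOrder in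
theorem trace_mul_nonneg {x y : Mat d} (hx : x.PosSemidef) (hy : y.PosSemidef) :
    0 ≤ (x * y).trace := by
  obtain ⟨B, rfl⟩ : ∃ B : Mat d, x = Bᴴ * B :=
    CStarAlgebra.nonneg_iff_eq_star_mul_self.1 (Matrix.nonneg_iff_posSemidef.2 hx)
  rw [Matrix.mul_assoc, Matrix.trace_mul_comm]
  exact (hy.mul_mul_conjTranspose_same B).trace_nonneg

theorem posSemidef_of_trace_mul_nonneg {x : Mat d} (hx : x.IsHermitian)
    (h : ∀ y : Mat d, y.PosSemidef → 0 ≤ (x * y).trace.re) : x.PosSemidef := by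
  refine .of_dotProduct_mulVec_nonneg hx fun v => ?_
  have hv := h _ (Matrix.posSemidef_vecMulVec_self_star v)
  rw [Matrix.mul_vecMulVec, Matrix.trace_vecMulVec, dotProduct_comm] at hv
  refine Complex.le_def.2 ⟨hv, ?_⟩
  have := hx.im_star_dotProduct_mulVec_self v
  simpa using this.symm

open scoped Matrix.Norms.L2Operator MatrixOrder in
theorem exists_posSemidef_smul_one_add {x : Mat d} (hx : x.IsHermitian) :
    ∃ c : ℝ, 0 < c ∧ ((c : ℂ) • (1 : Mat d) + x).PosSemidef ∧
      ((c : ℂ) • (1 : Mat d) - x).PosSemidef := by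
  have hsa : IsSelfAdjoint x := hx
  have h1 : ∀ c : ℝ, algebraMap ℝ (Mat d) c = (c : ℂ) • (1 : Mat d) := fun c => by
    rw [Algebra.algebraMap_eq_smul_one]
    ext i j
    simp
  have hone : ((1 : ℂ) • (1 : Mat d)).PosSemidef := by
    rw [one_smul]; exact Matrix.PosSemidef.one
  refine ⟨‖x‖ + 1, by positivity, ?_, ?_⟩
  · have := Matrix.le_iff.1 (IsSelfAdjoint.neg_algebraMap_norm_le_self hsa)
    rw [h1] at this
    have h2 := this.add hone
    have e : x - -((‖x‖ : ℂ) • (1 : Mat d)) + (1 : ℂ) • (1 : Mat d)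
      = ((‖x‖ + 1 : ℝ) : ℂ) • (1 : Mat d) + x := by
      push_cast
      rw [add_smul]; abel
    rwa [e] at h2
  · have := Matrix.le_iff.1 (IsSelfAdjoint.le_algebraMap_norm_self hsa)
    rw [h1] at this
    have h2 := this.add hone
    have e : ((‖x‖ : ℂ) • (1 : Mat d)) - x + (1 : ℂ) • (1 : Mat d)
      = ((‖x‖ + 1 : ℝ) : ℂ) • (1 : Mat d) - x := by
      push_cast
      rw [add_smul]; abel
    rwa [e] at h2

open scoped MatrixOrder in
theorem eq_zero_of_posSemidef_neg {x : Mat d} (h1 : x.PosSemidef) (h2 : (-x).PosSemidef) :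
    x = 0 := by
  refine le_antisymm (Matrix.le_iff.2 ?_) (Matrix.nonneg_iff_posSemidef.2 h1)
  rwa [zero_sub]

/-- A complex subspace of matrices closed under adjoints is trivial as soon as it contains no
nonzero Hermitian matrix. -/
theorem eq_zero_of_hermitian_part (p : Submodule ℂ (Mat d)) (hp : ∀ x ∈ p, xᴴ ∈ p)
    (h : ∀ x ∈ p, x.IsHermitian → x = 0) {x : Mat d} (hx : x ∈ p) : x = 0 := by
  have h1 : x + xᴴ = 0 := h _ (p.add_mem hx (hp x hx)) (by
    rw [Matrix.IsHermitian, Matrix.conjTranspose_add, Matrix.conjTranspose_conjTranspose, add_comm])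
  have h2 : Complex.I • (x - xᴴ) = 0 := h _ (p.smul_mem _ (p.sub_mem hx (hp x hx))) (by
    rw [Matrix.IsHermitian, Matrix.conjTranspose_smul, Matrix.conjTranspose_sub,
      Matrix.conjTranspose_conjTranspose, ← neg_sub x, smul_neg]
    simp)
  have h3 : x - xᴴ = 0 := (smul_eq_zero.1 h2).resolve_left Complex.I_ne_zero
  have h4 : (2 : ℂ) • x = 0 := by
    rw [two_smul]
    have : x + x = (x + xᴴ) + (x - xᴴ) := by abel
    rw [this, h1, h3, add_zero]
  exact (smul_eq_zero.1 h4).resolve_left two_ne_zero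

end Trace

/-! ### The KMS inner product space -/

theorem norm_apply_le_sInf {E : Type*} [NormedAddCommGroup E] [InnerProductSpace ℂ E]
    [FiniteDimensional ℂ E] (η : E →ₗ[ℂ] E) (x : E) :
    ‖η x‖ ≤ sInf {c : ℝ | 0 ≤ c ∧ ∀ x, ‖η x‖ ≤ c * ‖x‖} * ‖x‖ :=
  (LinearMap.toContinuousLinearMap η).le_opNorm x


section KMS

variable {d : ℕ} {σ : Mat d}

theorem mpow_half_mul_neg_half (hσ : σ.PosDef) : mpow σ (1 / 2) * mpow σ (-(1 / 2)) = 1 := by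
  rw [mpow_mul hσ, add_neg_cancel, mpow_zero hσ]

theorem mpow_neg_half_mul_half (hσ : σ.PosDef) : mpow σ (-(1 / 2)) * mpow σ (1 / 2) = 1 := by
  rw [mpow_mul hσ, neg_add_cancel, mpow_zero hσ]

theorem mpow_half_mul_half (hσ : σ.PosDef) : mpow σ (1 / 2) * mpow σ (1 / 2) = σ := by
  rw [mpow_mul hσ, add_halves, mpow_one hσ]

theorem half_mul_neg_half_mul (hσ : σ.PosDef) (x : Mat d) :
    mpow σ (1 / 2) * (mpow σ (-(1 / 2)) * x * mpow σ (-(1 / 2))) * mpow σ (1 / 2) = x := by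
  calc _ = (mpow σ (1 / 2) * mpow σ (-(1 / 2))) * x * (mpow σ (-(1 / 2)) * mpow σ (1 / 2)) := by
        simp only [Matrix.mul_assoc]
    _ = x := by rw [mpow_half_mul_neg_half hσ, mpow_neg_half_mul_half hσ, one_mul, mul_one]

theorem neg_half_mul_half_mul (hσ : σ.PosDef) (x : Mat d) :
    mpow σ (-(1 / 2)) * (mpow σ (1 / 2) * x * mpow σ (1 / 2)) * mpow σ (-(1 / 2)) = x := by
  calc _ = (mpow σ (-(1 / 2)) * mpow σ (1 / 2)) * x * (mpow σ (1 / 2) * mpow σ (-(1 / 2))) := by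
        simp only [Matrix.mul_assoc]
    _ = x := by rw [mpow_half_mul_neg_half hσ, mpow_neg_half_mul_half hσ, one_mul, mul_one]

theorem kmsInner_eq_trace_quarter (hσ : σ.PosDef) (x y : Mat d) :
    kmsInner σ x y = ((mpow σ (1 / 4) * x * mpow σ (1 / 4))ᴴ *
      (mpow σ (1 / 4) * y * mpow σ (1 / 4))).trace := by
  have h : mpow σ (1 / 2) = mpow σ (1 / 4) * mpow σ (1 / 4) := by
    rw [mpow_mul hσ]; norm_num
  rw [kmsInner, h]
  simp only [Matrix.conjTranspose_mul, mpow_herm]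
  rw [← Matrix.mul_assoc _ _ (mpow σ (1 / 4)), ← Matrix.mul_assoc _ _ (mpow σ (1 / 4)),
    Matrix.trace_mul_comm _ (mpow σ (1 / 4))]
  simp only [Matrix.mul_assoc]

/-- The KMS inner product as an inner product on the complex vector space `M_d(ℂ)`. -/
@[reducible]
def kmsCore (hσ : σ.PosDef) : InnerProductSpace.Core ℂ (Mat d) where
  inner := kmsInner σ
  conj_inner_symm x y := by
    rw [kmsInner_eq_trace_quarter hσ, kmsInner_eq_trace_quarter hσ, starRingEnd_apply,
      ← Matrix.trace_conjTranspose, Matrix.conjTranspose_mul, Matrix.conjTranspose_conjTranspose]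
  re_inner_nonneg x := by
    have := (Matrix.posSemidef_conjTranspose_mul_self
      (mpow σ (1 / 4) * x * mpow σ (1 / 4))).trace_nonneg
    rw [← kmsInner_eq_trace_quarter hσ] at this
    exact (Complex.le_def.1 this).1
  add_left x y z := by
    simp [kmsInner, Matrix.mul_add, Matrix.add_mul]
  smul_left x y r := by
    simp [kmsInner]
  definite x hx := by
    change kmsInner σ x x = 0 at hx
    rw [kmsInner_eq_trace_quarter hσ, Matrix.trace_conjTranspose_mul_self_eq_zero_iff] at hx
    have h1 : mpow σ (-(1 / 4)) * mpow σ (1 / 4) = 1 := by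
      rw [mpow_mul hσ, neg_add_cancel, mpow_zero hσ]
    have h2 : mpow σ (1 / 4) * mpow σ (-(1 / 4)) = 1 := by
      rw [mpow_mul hσ, add_neg_cancel, mpow_zero hσ]
    calc x = (mpow σ (-(1 / 4)) * mpow σ (1 / 4)) * x * (mpow σ (1 / 4) * mpow σ (-(1 / 4))) := by
          rw [h1, h2, one_mul, mul_one]
      _ = mpow σ (-(1 / 4)) * (mpow σ (1 / 4) * x * mpow σ (1 / 4)) * mpow σ (-(1 / 4)) := by
          simp only [Matrix.mul_assoc]
      _ = 0 := by rw [hx, mul_zero, zero_mul]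

theorem conj_kmsInner (hσ : σ.PosDef) (x y : Mat d) :
    (starRingEnd ℂ) (kmsInner σ y x) = kmsInner σ x y :=
  (kmsCore hσ).conj_inner_symm x y

theorem kmsInner_self_nonneg (hσ : σ.PosDef) (x : Mat d) : 0 ≤ (kmsInner σ x x).re :=
  (kmsCore hσ).re_inner_nonneg x

theorem kmsNorm_sq (hσ : σ.PosDef) (x : Mat d) : kmsNorm σ x ^ 2 = (kmsInner σ x x).re :=
  Real.sq_sqrt (kmsInner_self_nonneg hσ x)

theorem kmsInner_add_right (x y z : Mat d) :
    kmsInner σ x (y + z) = kmsInner σ x y + kmsInner σ x z := by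
  simp [kmsInner, Matrix.mul_add]

theorem kmsInner_smul_right (c : ℂ) (x y : Mat d) :
    kmsInner σ x (c • y) = c * kmsInner σ x y := by
  simp [kmsInner]

theorem kmsInner_one_left (hσ : σ.PosDef) (x : Mat d) : kmsInner σ 1 x = (σ * x).trace := by
  rw [kmsInner, Matrix.conjTranspose_one, mul_one, mpow_half_mul_half hσ]

theorem norm_kmsInner_le (hσ : σ.PosDef) (x y : Mat d) :
    ‖kmsInner σ x y‖ ≤ kmsNorm σ x * kmsNorm σ y := by
  let _ : NormedAddCommGroup (Mat d) := (kmsCore hσ).toNormedAddCommGroup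
  let _ : InnerProductSpace ℂ (Mat d) := InnerProductSpace.ofCore (kmsCore hσ).toCore
  exact norm_inner_le_norm (𝕜 := ℂ) x y

theorem kmsNorm_apply_le (hσ : σ.PosDef) (η : Mat d →ₗ[ℂ] Mat d) (x : Mat d) :
    kmsNorm σ (η x) ≤ kmsOpNorm σ η * kmsNorm σ x := by
  let _ : NormedAddCommGroup (Mat d) := (kmsCore hσ).toNormedAddCommGroup
  let _ : InnerProductSpace ℂ (Mat d) := InnerProductSpace.ofCore (kmsCore hσ).toCore
  exact norm_apply_le_sInf η x

theorem kmsOpNorm_nonneg (η : Mat d →ₗ[ℂ] Mat d) : 0 ≤ kmsOpNorm σ η :=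
  Real.sInf_nonneg fun _ hc => hc.1

theorem kmsAdjoint_herm {η : Mat d →ₗ[ℂ] Mat d} (hη : ∀ x, η xᴴ = (η x)ᴴ) (x : Mat d) :
    kmsAdjoint σ η xᴴ = (kmsAdjoint σ η x)ᴴ := by
  simp only [kmsAdjoint, Gam, LinearMap.comp_apply, LinearMap.mulLeftRight_apply,
    Matrix.conjTranspose_mul, mpow_herm, ← traceDual_herm hη, Matrix.mul_assoc]

theorem kmsRe_herm {η : Mat d →ₗ[ℂ] Mat d} (hη : ∀ x, η xᴴ = (η x)ᴴ) (x : Mat d) :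
    kmsRe σ η xᴴ = (kmsRe σ η x)ᴴ := by
  simp [kmsRe, hη, kmsAdjoint_herm hη, Matrix.conjTranspose_smul]

theorem kmsInner_apply_left (hσ : σ.PosDef) {η : Mat d →ₗ[ℂ] Mat d}
    (hη : ∀ x, η xᴴ = (η x)ᴴ) (x y : Mat d) :
    kmsInner σ (η x) y = kmsInner σ x (kmsAdjoint σ η y) := by
  rw [← conj_kmsInner hσ, ← kmsInner_kmsAdjoint hσ hη, conj_kmsInner hσ]

theorem kmsRe_symm (hσ : σ.PosDef) {η : Mat d →ₗ[ℂ] Mat d}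
    (hη : ∀ x, η xᴴ = (η x)ᴴ) (x y : Mat d) :
    kmsInner σ (kmsRe σ η x) y = kmsInner σ x (kmsRe σ η y) := by
  have h1 := kmsInner_kmsAdjoint hσ hη x y
  have h2 := kmsInner_apply_left hσ hη x y
  have h3 : kmsInner σ (kmsRe σ η x) y =
      (1 / 2) * (kmsInner σ (η x) y + kmsInner σ (kmsAdjoint σ η x) y) := by
    rw [← conj_kmsInner hσ, kmsRe, LinearMap.smul_apply, LinearMap.add_apply,
      kmsInner_smul_right, kmsInner_add_right, map_mul, map_add, conj_kmsInner hσ,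
      conj_kmsInner hσ, map_div₀, map_one, map_ofNat]
  rw [h3, h1, h2, kmsRe, LinearMap.smul_apply, LinearMap.add_apply,
    kmsInner_smul_right, kmsInner_add_right, add_comm]

theorem re_kmsInner_kmsRe (hσ : σ.PosDef) {η : Mat d →ₗ[ℂ] Mat d}
    (hη : ∀ x, η xᴴ = (η x)ᴴ) (x : Mat d) :
    (kmsInner σ x (kmsRe σ η x)).re = (kmsInner σ x (η x)).re := by
  rw [kmsRe, LinearMap.smul_apply, LinearMap.add_apply, kmsInner_smul_right, kmsInner_add_right,
    ← kmsInner_apply_left hσ hη, ← conj_kmsInner hσ (η x)]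
  have : (1 / 2 : ℂ) = ((1 / 2 : ℝ) : ℂ) := by norm_num
  rw [this, Complex.re_ofReal_mul, Complex.add_re, Complex.conj_re]
  ring

theorem traceDual_kmsRe (hσ : σ.PosDef) {η : Mat d →ₗ[ℂ] Mat d}
    (hη : ∀ x, η xᴴ = (η x)ᴴ) (x : Mat d) :
    traceDual (kmsRe σ η) (mpow σ (1 / 2) * x * mpow σ (1 / 2)) =
      mpow σ (1 / 2) * kmsRe σ η x * mpow σ (1 / 2) := by
  refine Matrix.ext_iff_trace_mul_right.2 fun z => ?_
  rw [trace_traceDual_mul]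
  have h := kmsRe_symm hσ hη xᴴ z
  rw [kmsRe_herm hη] at h
  simpa only [kmsInner, Matrix.conjTranspose_conjTranspose] using h.symm

end KMS

/-! ### The real part of the generator -/

section Generator

open Module.End

variable {d : ℕ} {ι : Type*} [Fintype ι] {H σ : Mat d} {L : ι → Mat d}

theorem jumpMap_apply (V x : Mat d) : jumpMap V x = Vᴴ * x * V := rfl

theorem jumpMap_herm (V x : Mat d) : jumpMap V xᴴ = (jumpMap V x)ᴴ := by
  simp [jumpMap_apply, Matrix.mul_assoc]

theorem gkls_herm (hH : H.IsHermitian) (x : Mat d) : gkls H L xᴴ = (gkls H L x)ᴴ := by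
  simp only [gkls_apply, Matrix.conjTranspose_add, Matrix.conjTranspose_neg,
    Matrix.conjTranspose_smul, Matrix.conjTranspose_sub, Matrix.conjTranspose_mul,
    Matrix.conjTranspose_sum, Matrix.conjTranspose_conjTranspose, hH.eq, Complex.star_def,
    Complex.conj_I, Matrix.mul_assoc]
  congr 1
  · rw [← smul_neg, neg_sub, neg_smul, neg_neg]
  · refine Finset.sum_congr rfl fun j _ => ?_
    rw [add_comm (xᴴ * ((L j)ᴴ * L j)), map_div₀, map_one, map_ofNat]

theorem gkls_one : gkls H L 1 = 0 := by
  rw [gkls_apply]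
  simp only [mul_one, one_mul, sub_self, smul_zero, neg_zero, zero_add]
  refine Finset.sum_eq_zero fun j _ => ?_
  rw [← two_smul ℂ, smul_smul]
  norm_num

theorem kmsRe_gkls_one (hσ : σ.PosDef) (hinv : traceDual (gkls H L) σ = 0) :
    kmsRe σ (gkls H L) 1 = 0 := by
  simp only [kmsRe, LinearMap.smul_apply, LinearMap.add_apply, gkls_one, kmsAdjoint, Gam,
    LinearMap.comp_apply, LinearMap.mulLeftRight_apply, mul_one, mpow_half_mul_half hσ, hinv,
    mul_zero, zero_mul, add_zero, smul_zero]

/-- For a KMS-selfadjoint generator with a unique faithful invariant state, a fixed point `x`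
gives the invariant functional `σ^{1/2} x σ^{1/2}`, so a small perturbation of `σ` by it is again
a faithful invariant state. -/
theorem exists_eq_smul_one {η : Mat d →ₗ[ℂ] Mat d} (hσ : IsFaithfulState σ)
    (hη : ∀ x, η xᴴ = (η x)ᴴ) (h1 : kmsRe σ η 1 = 0)
    (huniq : ∃ τ, IsUniqueFaithfulInvariantState (kmsRe σ η) τ) {x : Mat d}
    (hx : kmsRe σ η x = 0) : ∃ c : ℂ, x = c • (1 : Mat d) := by
  obtain ⟨τ, -, -, hτ⟩ := huniq
  have hPd := hσ.1
  set P := mpow σ (1 / 2) with hP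
  have hPH : Pᴴ = P := mpow_herm _
  have hinv : ∀ x, kmsRe σ η x = 0 → traceDual (kmsRe σ η) (P * x * P) = 0 := fun x hx => by
    rw [traceDual_kmsRe hPd hη, hx, mul_zero, zero_mul]
  have hστ : σ = τ := by
    refine hτ σ hσ ?_
    have := hinv 1 h1
    rwa [mul_one, mpow_half_mul_half hPd] at this
  let f : Mat d →ₗ[ℂ] ℂ := Matrix.traceLinearMap (Fin d) ℂ ℂ ∘ₗ LinearMap.mulLeftRight ℂ (P, P)
  have hf : ∀ x, f x = (P * x * P).trace := fun x => rfl
  have key : ∀ x ∈ LinearMap.ker (kmsRe σ η) ⊓ LinearMap.ker f, x = 0 := by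
    intro x hx
    refine eq_zero_of_hermitian_part (LinearMap.ker (kmsRe σ η) ⊓ LinearMap.ker f) ?_ ?_ hx
    · rintro x ⟨hx1, hx2⟩
      have hx1 : kmsRe σ η x = 0 := hx1
      have hx2 : (P * x * P).trace = 0 := hx2
      refine ⟨?_, ?_⟩
      · change kmsRe σ η xᴴ = 0
        rw [kmsRe_herm hη, hx1, Matrix.conjTranspose_zero]
      · change (P * xᴴ * P).trace = 0
        have : P * xᴴ * P = (P * x * P)ᴴ := by
          simp only [Matrix.conjTranspose_mul, hPH, Matrix.mul_assoc]
        rw [this, Matrix.trace_conjTranspose, hx2, star_zero]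
    · rintro x ⟨hx1, hx2⟩ hxH
      have hx1 : kmsRe σ η x = 0 := hx1
      have hx2 : (P * x * P).trace = 0 := hx2
      obtain ⟨c, hc, hpos, -⟩ := exists_posSemidef_smul_one_add hxH
      have hc2 : (0 : ℂ) < ((2 * c : ℝ) : ℂ) := by
        rw [Complex.zero_lt_real]; positivity
      have hcc : (0 : ℂ) < (c : ℂ) := by rw [Complex.zero_lt_real]; exact hc
      set s : ℂ := ((2 * c : ℝ) : ℂ)
      have hs : s⁻¹ ≠ 0 := inv_ne_zero hc2.ne'
      have hpd : (s • (1 : Mat d) + x).PosDef := by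
        have : s • (1 : Mat d) + x = (c : ℂ) • (1 : Mat d) + ((c : ℂ) • (1 : Mat d) + x) := by
          rw [← add_assoc, ← add_smul]
          congr 2
          simp only [s]; push_cast; ring
        rw [this]
        exact (Matrix.PosDef.one.smul hcc).add_posSemidef hpos
      have hpd2 : (P * (s • (1 : Mat d) + x) * P).PosDef := by
        have hU : IsUnit P := IsUnit.of_mul_eq_one _ (mpow_half_mul_neg_half hPd)
        have := (Matrix.IsUnit.posDef_star_right_conjugate_iff (x := s • (1 : Mat d) + x) hU).2 hpd
        rwa [Matrix.star_eq_conjTranspose, hPH] at this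
      have hexp : s⁻¹ • (P * (s • (1 : Mat d) + x) * P) = σ + s⁻¹ • (P * x * P) := by
        rw [mul_add, add_mul, smul_add, mul_smul_comm, smul_mul_assoc, smul_smul,
          inv_mul_cancel₀ hc2.ne', one_smul, mul_one, mpow_half_mul_half hPd]
      have hst := hτ (s⁻¹ • (P * (s • (1 : Mat d) + x) * P))
        ⟨hpd2.smul (inv_pos.2 hc2), by rw [hexp, Matrix.trace_add, hσ.2, Matrix.trace_smul, hx2,
          smul_zero, add_zero]⟩
        (by rw [map_smul, hinv, smul_zero]
            rw [map_add, map_smul, h1, hx1, smul_zero, add_zero])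
      rw [hexp, ← hστ, add_eq_left, smul_eq_zero] at hst
      rw [← neg_half_mul_half_mul hPd x, ← hP, hst.resolve_left hs, mul_zero, zero_mul]
  refine ⟨f x, ?_⟩
  rw [← sub_eq_zero]
  refine key _ ⟨?_, ?_⟩
  · change kmsRe σ η _ = 0
    rw [map_sub, map_smul, hx, h1, smul_zero, sub_zero]
  · change f _ = 0
    have : f 1 = 1 := by rw [hf, mul_one, mpow_half_mul_half hPd, hσ.2]
    rw [map_sub, map_smul, this, smul_eq_mul, mul_one, sub_self]

theorem expMap_apply_of_eigenvector {K : Mat d →ₗ[ℂ] Mat d} {μ : ℝ} {x : Mat d}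
    (hx : K x = (μ : ℂ) • x) (t : ℝ) : expMap K t x = ((Real.exp (t * μ) : ℝ) : ℂ) • x := by
  have hpow : ∀ n : ℕ, (K ^ n) x = (μ : ℂ) ^ n • x := by
    intro n
    induction n with
    | zero => simp
    | succ n ih => rw [pow_succ, Module.End.mul_apply, hx, map_smul, ih, smul_smul, pow_succ']
  have hsum : HasSum (fun n : ℕ => (((t * μ : ℝ) : ℂ) ^ n / (n.factorial : ℂ)))
      ((Real.exp (t * μ) : ℝ) : ℂ) := by
    have := NormedSpace.expSeries_div_hasSum_exp ((t * μ : ℝ) : ℂ)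
    rwa [← Complex.exp_eq_exp_ℂ, ← Complex.ofReal_exp] at this
  rw [expMap, ← (hsum.smul_const x).tsum_eq]
  refine tsum_congr fun n => ?_
  rw [hpow, smul_smul]
  congr 1
  push_cast
  ring

/-- Channels preserve `-c ≤ x ≤ c`, so a generator of a quantum Markov semigroup has no positive
eigenvalue. -/
theorem eigenvalue_nonpos {K : Mat d →ₗ[ℂ] Mat d} (hK : GeneratesQMS K)
    (hherm : ∀ x, K xᴴ = (K x)ᴴ) {μ : ℝ} (hμ : HasEigenvalue K (μ : ℂ)) : μ ≤ 0 := by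
  by_contra! hpos
  obtain ⟨x, hx⟩ := hμ.exists_hasEigenvector
  refine hx.2 (eq_zero_of_hermitian_part (eigenspace K (μ : ℂ)) (fun y hy => ?_)
    (fun y hy hyH => ?_) hx.1)
  · rw [mem_eigenspace_iff] at hy ⊢
    rw [hherm, hy, Matrix.conjTranspose_smul]
    simp
  · have key : ∀ y ∈ eigenspace K (μ : ℂ), y.IsHermitian → (-y).PosSemidef := by
      intro y hy hyH
      rw [mem_eigenspace_iff] at hy
      obtain ⟨c, hc, -, hcy⟩ := exists_posSemidef_smul_one_add hyH
      have hbound : ∀ s : ℝ, 0 ≤ s →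
          ((c : ℂ) • (1 : Mat d) - ((Real.exp (s * μ) : ℝ) : ℂ) • y).PosSemidef := by
        intro s hs
        obtain ⟨⟨n, W, hW⟩, hone⟩ := hK s hs
        rw [← expMap_apply_of_eigenvector hy, ← hone, hW, hW, Finset.smul_sum,
          ← Finset.sum_sub_distrib]
        refine Matrix.posSemidef_sum _ fun j _ => ?_
        have := hcy.conjTranspose_mul_mul_same (W j)
        rwa [mul_sub, sub_mul, mul_smul_comm, smul_mul_assoc] at this
      refine posSemidef_of_trace_mul_nonneg hyH.neg fun z hz => ?_
      rw [neg_mul, Matrix.trace_neg, Complex.neg_re, Left.nonneg_neg_iff]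
      by_contra! hq
      set q := (y * z).trace.re with hqd
      have hz0 : 0 ≤ z.trace.re := (Complex.le_def.1 hz.trace_nonneg).1
      have h := (Complex.le_def.1 (trace_mul_nonneg
        (hbound (c * z.trace.re / (μ * q)) (by positivity)) hz)).1
      rw [sub_mul, Matrix.trace_sub, smul_mul_assoc, smul_mul_assoc, Matrix.trace_smul,
        Matrix.trace_smul, one_mul, smul_eq_mul, smul_eq_mul, Complex.sub_re,
        Complex.re_ofReal_mul, Complex.re_ofReal_mul, ← hqd, Complex.zero_re] at h
      have h2 := mul_le_mul_of_nonneg_right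
        (Real.add_one_le_exp (c * z.trace.re / (μ * q) * μ)) hq.le
      have h3 : c * z.trace.re / (μ * q) * μ * q = c * z.trace.re := by
        field_simp
      rw [add_mul, h3] at h2
      linarith
    refine eq_zero_of_posSemidef_neg ?_ (key y hy hyH)
    have := key (-y) (Submodule.neg_mem _ hy) hyH.neg
    rwa [neg_neg] at this

/-- The bound on the numerical range of the real part of the tilted generator. -/
theorem re_kmsInner_tilted_le {m α b ε r δ : ℝ} (hH : H.IsHermitian)
    (hσ : IsFaithfulState σ) (hinv : traceDual (gkls H L) σ = 0)
    (hirr : GeneratesIrreducibleQMS (kmsRe σ (gkls H L))) (i : ι)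
    (hm : m = ((L i)ᴴ * L i * σ).trace.re)
    (hα : α = kmsOpNorm σ (kmsRe σ (jumpMap (L i))))
    (hb : b = kmsNorm σ (kmsRe σ (jumpMap (L i)) 1))
    (hε : ε = spectralGap (kmsRe σ (gkls H L)))
    (hr : 0 ≤ r) (hδ : 0 ≤ δ)
    (h : 0 < ε → r * α < ε ∧ r ^ 2 * b ^ 2 ≤ δ * (ε - r * α)) (x : Mat d) :
    (kmsInner σ x (gkls H L x + (r : ℂ) • jumpMap (L i) x)).re ≤
      (r * m + δ) * (kmsInner σ x x).re := by
  have hPd := hσ.1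
  have hgH := gkls_herm (L := L) hH
  have hjH := jumpMap_herm (L i)
  have hAe := kmsRe_gkls_one hPd hinv
  have hm' : (kmsInner σ 1 (kmsRe σ (jumpMap (L i)) 1)).re = m := by
    rw [re_kmsInner_kmsRe hPd hjH, kmsInner_one_left hPd, jumpMap_apply, mul_one, hm,
      Matrix.trace_mul_comm]
  have hm0 : 0 ≤ m := by
    rw [hm]
    exact (Complex.le_def.1 (trace_mul_nonneg
      (Matrix.posSemidef_conjTranspose_mul_self (L i)) hPd.posSemidef)).1
  have hone : kmsNorm σ 1 = 1 := by
    rw [kmsNorm, kmsInner_one_left hPd, mul_one, hσ.2]; simp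
  have hker : ∀ x, kmsRe σ (gkls H L) x = 0 → ∃ c : ℂ, x = c • (1 : Mat d) :=
    fun x hx => exists_eq_smul_one hσ hgH hAe hirr.2 hx
  have hneg : ∀ μ : ℝ, HasEigenvalue (kmsRe σ (gkls H L)) (μ : ℂ) → μ ≤ 0 :=
    fun μ hμ => eigenvalue_nonpos hirr.1 (kmsRe_herm hgH) hμ
  have hre : (kmsInner σ x (gkls H L x + (r : ℂ) • jumpMap (L i) x)).re =
      (kmsInner σ x ((kmsRe σ (gkls H L) + (r : ℂ) • kmsRe σ (jumpMap (L i))) x)).re := by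
    rw [LinearMap.add_apply, LinearMap.smul_apply, kmsInner_add_right, kmsInner_add_right,
      kmsInner_smul_right, kmsInner_smul_right, Complex.add_re, Complex.add_re,
      Complex.re_ofReal_mul, Complex.re_ofReal_mul, re_kmsInner_kmsRe hPd hgH,
      re_kmsInner_kmsRe hPd hjH]
  have hBb := kmsNorm_apply_le hPd (kmsRe σ (jumpMap (L i)))
  rw [hre, ← hm', ← kmsNorm_sq hPd]
  rw [← hα] at hBb
  rw [← hm'] at hm0
  let _ : NormedAddCommGroup (Mat d) := (kmsCore hPd).toNormedAddCommGroup
  let _ : InnerProductSpace ℂ (Mat d) := InnerProductSpace.ofCore (kmsCore hPd).toCore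
  have hAs : (kmsRe σ (gkls H L)).IsSymmetric := kmsRe_symm hPd hgH
  have hBs : (kmsRe σ (jumpMap (L i))).IsSymmetric := kmsRe_symm hPd hjH
  refine re_inner_perturbation_le (e := (1 : Mat d)) hAs hBs hone hAe (ε := ε) ?_ hBb hr hδ hm0 ?_ x
  · intro y hy
    rw [hε]
    exact re_inner_apply_le_neg_gap hAs hneg hker hy
  · rcases gap_pos_or_eq_zero hAs hneg hker with h0 | h0
    · refine Or.inr ?_
      have h1 := h (by rw [hε]; exact h0)
      rwa [hb] at h1
    · exact Or.inl h0

end Generator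

/-! ### Unravelling by the number of clicks -/

section Unravelling

open scoped Matrix.Norms.Operator

variable {d : ℕ} {ι : Type*} [Fintype ι] (H : Mat d) (L : ι → Mat d) (c : ι → ℝ)

/-- The propagator `e^{sG}` between detections. -/
def propagator (s : ℝ) : Mat d := NormedSpace.exp ((s : ℂ) • effG H L)

/-- The jump part `ρ ↦ ∑ⱼ cⱼ Lⱼ ρ Lⱼ^*` of the dual generator, with each detector weighted by
`cⱼ`. -/
def weightedJump : Mat d →ₗ[ℂ] Mat d :=
  ∑ j, (c j : ℂ) • LinearMap.mulLeftRight ℂ (L j, (L j)ᴴ)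

theorem weightedJump_apply (y : Mat d) :
    weightedJump L c y = ∑ j, (c j : ℂ) • (L j * y * (L j)ᴴ) := by
  simp [weightedJump, LinearMap.sum_apply, LinearMap.mulLeftRight_apply]

theorem noJump_eq (s : ℝ) (y : Mat d) :
    noJump H L s y = propagator H L s * y * (propagator H L s)ᴴ := by
  rw [noJump, propagator, ← Matrix.exp_conjTranspose, Matrix.conjTranspose_smul]
  simp

/-- `noJump` as a linear map. -/
def noJumpMap (s : ℝ) : Mat d →ₗ[ℂ] Mat d :=
  LinearMap.mulLeftRight ℂ (propagator H L s, (propagator H L s)ᴴ)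

theorem noJumpMap_apply (s : ℝ) (y : Mat d) : noJumpMap H L s y = noJump H L s y := by
  rw [noJump_eq]; rfl

/-- The weighted, unnormalized state at time `t` after exactly `k` clicks, integrated over all click
times and summed over all words. -/
def clickPart (ρ : Mat d) : ℕ → ℝ → Mat d
  | 0, t => noJump H L t ρ
  | k + 1, t => noJump H L t
      (∫ s in (0 : ℝ)..t, noJump H L (-s) (weightedJump L c (clickPart ρ k s)))

variable {H L c}

theorem propagator_add (s r : ℝ) :
    propagator H L (s + r) = propagator H L s * propagator H L r := by
  rw [propagator, Complex.ofReal_add, add_smul, Matrix.exp_add_of_commute]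
  · rfl
  · exact ((Commute.refl _).smul_left _).smul_right _

theorem propagator_zero : propagator H L 0 = 1 := by
  simp [propagator]

theorem noJump_noJump (s r : ℝ) (y : Mat d) :
    noJump H L s (noJump H L r y) = noJump H L (s + r) y := by
  simp only [noJump_eq, propagator_add, Matrix.conjTranspose_mul, Matrix.mul_assoc]

theorem noJump_zero (y : Mat d) : noJump H L 0 y = y := by
  simp [noJump_eq, propagator_zero]

theorem noJump_posSemidef {y : Mat d} (hy : y.PosSemidef) (s : ℝ) :
    (noJump H L s y).PosSemidef := by
  rw [noJump_eq]
  exact hy.mul_mul_conjTranspose_same _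

theorem weightedJump_posSemidef (hc : ∀ j, 0 ≤ c j) {y : Mat d} (hy : y.PosSemidef) :
    (weightedJump L c y).PosSemidef := by
  rw [weightedJump_apply]
  refine Matrix.posSemidef_sum _ fun j _ => ?_
  exact (hy.mul_mul_conjTranspose_same _).smul (Complex.zero_le_real.2 (hc j))

theorem hasDerivAt_propagator (t : ℝ) :
    HasDerivAt (propagator H L) (effG H L * propagator H L t) t := by
  have h := hasDerivAt_exp_smul_const' (𝕂 := ℝ) (effG H L) t
  exact h

theorem continuous_propagator : Continuous (propagator H L) :=
  continuous_iff_continuousAt.2 fun t => (hasDerivAt_propagator t).continuousAt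

theorem hasDerivAt_conjTranspose {f : ℝ → Mat d} {f' : Mat d} {t : ℝ} (hf : HasDerivAt f f' t) :
    HasDerivAt (fun s => (f s)ᴴ) f'ᴴ t :=
  (LinearMap.toContinuousLinearMap
    (Matrix.conjTransposeLinearEquiv (Fin d) (Fin d) ℝ ℂ).toLinearMap).hasFDerivAt.comp_hasDerivAt t hf

theorem hasDerivAt_noJump {y : ℝ → Mat d} {y' : Mat d} {t : ℝ} (hy : HasDerivAt y y' t) :
    HasDerivAt (fun s => noJump H L s (y s))
      (effG H L * noJump H L t (y t) + noJump H L t (y t) * (effG H L)ᴴ + noJump H L t y') t := by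
  have hE := hasDerivAt_propagator (H := H) (L := L) t
  have h := (hE.mul hy).mul (hasDerivAt_conjTranspose hE)
  simp only [noJump_eq]
  convert! h using 1
  simp only [Pi.mul_apply, Matrix.conjTranspose_mul, add_mul, Matrix.mul_assoc]
  abel

theorem continuous_noJump {X : Type*} [TopologicalSpace X] {s : X → ℝ} {y : X → Mat d}
    (hs : Continuous s) (hy : Continuous y) : Continuous fun p => noJump H L (s p) (y p) := by
  simp only [noJump_eq]
  have hE := (continuous_propagator (H := H) (L := L)).comp hs
  exact (hE.matrix_mul hy).matrix_mul hE.matrix_conjTranspose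

theorem continuous_weightedJump {X : Type*} [TopologicalSpace X] {y : X → Mat d}
    (hy : Continuous y) : Continuous fun p => weightedJump L c (y p) :=
  (LinearMap.toContinuousLinearMap (weightedJump L c)).continuous.comp hy

theorem intervalIntegral_linearMap {F : Type*} [NormedAddCommGroup F] [NormedSpace ℝ F]
    [CompleteSpace F] (φ : Mat d →ₗ[ℝ] F) {f : ℝ → Mat d} (hf : Continuous f) (t : ℝ) :
    φ (∫ s in (0 : ℝ)..t, f s) = ∫ s in (0 : ℝ)..t, φ (f s) :=
  ((LinearMap.toContinuousLinearMap φ).intervalIntegral_comp_comm (hf.intervalIntegrable 0 t)).symm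

/-- The real linear functional `y ↦ Re tr (y x)`. -/
def reTraceMul (x : Mat d) : Mat d →ₗ[ℝ] ℝ where
  toFun y := (y * x).trace.re
  map_add' y z := by simp [add_mul]
  map_smul' r y := by simp [Matrix.trace_smul]

theorem reTraceMul_apply (x y : Mat d) : reTraceMul x y = (y * x).trace.re := rfl

theorem posSemidef_intervalIntegral {f : ℝ → Mat d} (hf : Continuous f) {t : ℝ} (ht : 0 ≤ t)
    (hpos : ∀ s ∈ Set.Icc 0 t, (f s).PosSemidef) : (∫ s in (0 : ℝ)..t, f s).PosSemidef := by
  refine posSemidef_of_trace_mul_nonneg ?_ fun y hy => ?_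
  · have h := intervalIntegral_linearMap
      (Matrix.conjTransposeLinearEquiv (Fin d) (Fin d) ℝ ℂ).toLinearMap hf t
    refine h.trans (intervalIntegral.integral_congr fun s hs => ?_)
    rw [Set.uIcc_of_le ht] at hs
    exact (hpos s hs).isHermitian
  · rw [← reTraceMul_apply, intervalIntegral_linearMap _ hf]
    refine intervalIntegral.integral_nonneg ht fun s hs => ?_
    exact (Complex.le_def.1 (trace_mul_nonneg (hpos s hs) hy)).1

variable {ρ : Mat d}

theorem continuous_clickPart (k : ℕ) : Continuous (clickPart H L c ρ k) := by
  induction k with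
  | zero => exact continuous_noJump continuous_id continuous_const
  | succ k ih =>
    refine continuous_noJump continuous_id ?_
    refine intervalIntegral.continuous_primitive (fun a b => Continuous.intervalIntegrable ?_ a b) 0
    exact continuous_noJump continuous_neg (continuous_weightedJump ih)

theorem clickPart_posSemidef (hc : ∀ j, 0 ≤ c j) (hρ : ρ.PosSemidef) (k : ℕ) {t : ℝ}
    (ht : 0 ≤ t) : (clickPart H L c ρ k t).PosSemidef := by
  induction k generalizing t with
  | zero => exact noJump_posSemidef hρ t
  | succ k ih =>
    refine noJump_posSemidef (posSemidef_intervalIntegral ?_ ht fun s hs => ?_) t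
    · exact continuous_noJump continuous_neg (continuous_weightedJump (continuous_clickPart k))
    · exact noJump_posSemidef (weightedJump_posSemidef hc (ih hs.1)) _

theorem hasDerivAt_clickPart_zero (t : ℝ) :
    HasDerivAt (clickPart H L c ρ 0) (effG H L * clickPart H L c ρ 0 t +
      clickPart H L c ρ 0 t * (effG H L)ᴴ) t := by
  have h := hasDerivAt_noJump (H := H) (L := L) (hasDerivAt_const t ρ)
  have h0 : noJump H L t 0 = 0 := by simp [noJump_eq]
  rw [h0, add_zero] at h
  exact h

theorem hasDerivAt_clickPart_succ (k : ℕ) (t : ℝ) :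
    HasDerivAt (clickPart H L c ρ (k + 1)) (effG H L * clickPart H L c ρ (k + 1) t +
      clickPart H L c ρ (k + 1) t * (effG H L)ᴴ + weightedJump L c (clickPart H L c ρ k t)) t := by
  have hcont : Continuous fun s => noJump H L (-s) (weightedJump L c (clickPart H L c ρ k s)) :=
    continuous_noJump continuous_neg (continuous_weightedJump (continuous_clickPart k))
  have h := hasDerivAt_noJump (H := H) (L := L)
    (hcont.integral_hasStrictDerivAt 0 t).hasDerivAt
  rw [noJump_noJump, add_neg_cancel, noJump_zero] at h
  exact h

/-- The weighted, unnormalized state at time `t` of the records with at most `n` clicks. -/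
def truncatedState (H : Mat d) (L : ι → Mat d) (c : ι → ℝ) (ρ : Mat d) (n : ℕ) (t : ℝ) : Mat d :=
  ∑ k ∈ Finset.range (n + 1), clickPart H L c ρ k t

theorem truncatedState_posSemidef (hc : ∀ j, 0 ≤ c j) (hρ : ρ.PosSemidef) (n : ℕ) {t : ℝ}
    (ht : 0 ≤ t) : (truncatedState H L c ρ n t).PosSemidef :=
  Matrix.posSemidef_sum _ fun k _ => clickPart_posSemidef hc hρ k ht

/-- The truncated state solves the tilted master equation up to the loss term
`weightedJump (clickPart n)`, which is positive. -/
theorem hasDerivAt_truncatedState (n : ℕ) (t : ℝ) :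
    HasDerivAt (truncatedState H L c ρ n)
      (effG H L * truncatedState H L c ρ n t + truncatedState H L c ρ n t * (effG H L)ᴴ +
        weightedJump L c (truncatedState H L c ρ n t) -
        weightedJump L c (clickPart H L c ρ n t)) t := by
  induction n with
  | zero =>
    have h := hasDerivAt_clickPart_zero (H := H) (L := L) (c := c) (ρ := ρ) t
    have e : truncatedState H L c ρ 0 = clickPart H L c ρ 0 := by
      funext t; simp [truncatedState]
    rw [e, add_sub_cancel_right]
    exact h
  | succ n ih =>
    have h := ih.add (hasDerivAt_clickPart_succ (H := H) (L := L) (c := c) (ρ := ρ) n t)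
    have e : truncatedState H L c ρ (n + 1) =
        truncatedState H L c ρ n + clickPart H L c ρ (n + 1) := by
      funext t; simp [truncatedState, Finset.sum_range_succ]
    rw [e]
    convert! h using 1
    rw [Pi.add_apply, mul_add, add_mul, map_add]
    abel

end Unravelling

/-! ### The energy estimate -/

section Energy

open scoped Matrix.Norms.Operator

variable {d : ℕ} {ι : Type*} [DecidableEq ι]

/-- The weights that count the clicks of the detector `i` with a factor `1 + r` each. -/
def tiltWeight (i : ι) (r : ℝ) (j : ι) : ℝ := if j = i then 1 + r else 1

theorem tiltWeight_nonneg (i : ι) {r : ℝ} (hr : 0 ≤ r) (j : ι) : 0 ≤ tiltWeight i r j := by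
  unfold tiltWeight; split_ifs <;> linarith

variable [Fintype ι] {H σ ρ : Mat d} {L : ι → Mat d}

theorem weightedJump_tiltWeight (i : ι) (r : ℝ) (y : Mat d) :
    weightedJump L (tiltWeight i r) y =
      ∑ j, L j * y * (L j)ᴴ + (r : ℂ) • (L i * y * (L i)ᴴ) := by
  have h : ∀ j, ((tiltWeight i r j : ℝ) : ℂ) • (L j * y * (L j)ᴴ) =
      L j * y * (L j)ᴴ + if j = i then (r : ℂ) • (L j * y * (L j)ᴴ) else 0 := by
    intro j
    unfold tiltWeight
    split_ifs
    · push_cast; rw [add_smul, one_smul]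
    · simp
  rw [weightedJump_apply]
  simp only [h, Finset.sum_add_distrib, Finset.sum_ite_eq', Finset.mem_univ, if_true]

/-- The tilted master equation is the trace dual of `ℒ + r 𝒥ᵢ`. -/
theorem trace_mul_tilted (hH : H.IsHermitian) (i : ι) (r : ℝ) (x y : Mat d) :
    (x * (effG H L * y + y * (effG H L)ᴴ + weightedJump L (tiltWeight i r) y)).trace =
      (y * (gkls H L x + (r : ℂ) • jumpMap (L i) x)).trace := by
  have hG : (effG H L)ᴴ = -(Complex.I • H) - (1 / 2 : ℂ) • ∑ j, (L j)ᴴ * L j := by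
    simp [effG, Matrix.conjTranspose_sub, Matrix.conjTranspose_smul, Matrix.conjTranspose_sum, hH.eq]
  have hg : gkls H L x = (effG H L)ᴴ * x + x * effG H L + ∑ j, (L j)ᴴ * x * L j := by
    rw [gkls_apply, hG, effG, Finset.sum_sub_distrib, ← Finset.smul_sum, Finset.sum_add_distrib,
      ← Finset.sum_mul, ← Finset.mul_sum]
    simp only [sub_mul, mul_sub, neg_mul, smul_mul_assoc, mul_smul_comm, smul_add, smul_sub]
    abel
  rw [hg, weightedJump_tiltWeight, jumpMap_apply]
  simp only [mul_add, Matrix.trace_add, Finset.mul_sum, Matrix.trace_sum, mul_smul_comm,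
    Matrix.trace_smul]
  have h1 : (x * (effG H L * y)).trace = (y * (x * effG H L)).trace := by
    rw [← Matrix.mul_assoc, Matrix.trace_mul_comm]
  have h2 : (x * (y * (effG H L)ᴴ)).trace = (y * ((effG H L)ᴴ * x)).trace := by
    rw [Matrix.trace_mul_comm, Matrix.mul_assoc]
  have h3 : ∀ V : Mat d, (x * (V * y * Vᴴ)).trace = (y * (Vᴴ * x * V)).trace := fun V => by
    rw [Matrix.trace_mul_comm, Matrix.mul_assoc, Matrix.mul_assoc, Matrix.trace_mul_comm]
    simp only [Matrix.mul_assoc]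
  rw [h1, h2, h3]
  simp only [h3]
  ring

/-- The squared KMS norm of the density of the truncated state relative to `σ` grows at most at the
rate `2 Λ`, where `Λ` bounds the numerical range of the tilted generator: the loss term
contributes the trace of a product of positive matrices. The trace is the KMS inner product with
the unit vector `1`. -/
theorem trace_truncatedState_le (hH : H.IsHermitian) (hσ : IsFaithfulState σ) (i : ι) {r Λ : ℝ}
    (hr : 0 ≤ r)
    (hΛ : ∀ x, (kmsInner σ x (gkls H L x + (r : ℂ) • jumpMap (L i) x)).re ≤
      Λ * (kmsInner σ x x).re)
    (hρ : ρ.PosSemidef) (n : ℕ) {t : ℝ} (ht : 0 ≤ t) :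
    (truncatedState H L (tiltWeight i r) ρ n t).trace.re ≤
      kmsNorm σ (mpow σ (-(1 / 2)) * ρ * mpow σ (-(1 / 2))) * Real.exp (Λ * t) := by
  have hPd := hσ.1
  set c := tiltWeight i r with hcdef
  have hc : ∀ j, 0 ≤ c j := tiltWeight_nonneg i hr
  set S := truncatedState H L c ρ n with hS
  set Q := mpow σ (-(1 / 2)) with hQ
  have hQH : Qᴴ = Q := mpow_herm _
  have hSpos : ∀ s, 0 ≤ s → (S s).PosSemidef := fun s hs => truncatedState_posSemidef hc hρ n hs
  have hX : ∀ y : Mat d, y.PosSemidef → (Q * y * Q).PosSemidef := fun y hy => by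
    have := hy.mul_mul_conjTranspose_same Q
    rwa [hQH] at this
  have hinner : ∀ y z : Mat d, y.PosSemidef → kmsInner σ (Q * y * Q) z = (y * z).trace :=
    fun y z hy => by
      rw [kmsInner, (hX y hy).isHermitian.eq, half_mul_neg_half_mul hPd]
  have hsq : ∀ y : Mat d, y.PosSemidef →
      kmsNorm σ (Q * y * Q) ^ 2 = (Q * y * Q * y).trace.re := fun y hy => by
    rw [kmsNorm_sq hPd, hinner _ _ hy, Matrix.trace_mul_comm]
  let f : ℝ → ℝ := fun s => (Q * S s * Q * S s).trace.re
  have hder : ∀ s, 0 ≤ s → ∃ f', HasDerivAt f f' s ∧ f' ≤ 2 * Λ * f s := by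
    intro s hs
    obtain ⟨S', hS', hSe⟩ : ∃ S', HasDerivAt S S' s ∧ S' = effG H L * S s + S s * (effG H L)ᴴ +
        weightedJump L c (S s) - weightedJump L c (clickPart H L c ρ n s) :=
      ⟨_, hasDerivAt_truncatedState n s, rfl⟩
    have hprod := (((hS'.const_mul Q).mul_const Q).mul hS')
    have hf' := (LinearMap.toContinuousLinearMap
      (reTraceMul (1 : Mat d))).hasFDerivAt.comp_hasDerivAt s hprod
    have hf1 : HasDerivAt f ((Q * S' * Q * S s + Q * S s * Q * S') * 1).trace.re s := by
      refine HasDerivAt.congr_of_eventuallyEq (f := (LinearMap.toContinuousLinearMap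
        (reTraceMul (1 : Mat d))) ∘ fun s => Q * S s * Q * S s) hf' ?_
      refine Filter.Eventually.of_forall fun s => ?_
      change _ = (Q * S s * Q * S s * 1).trace.re
      rw [mul_one]
    refine ⟨_, hf1, ?_⟩
    have hcyc : (Q * S' * Q * S s).trace = (Q * S s * Q * S').trace := by
      rw [Matrix.mul_assoc, Matrix.trace_mul_comm, ← Matrix.mul_assoc]
    have hloss : 0 ≤ (Q * S s * Q * weightedJump L c (clickPart H L c ρ n s)).trace.re :=
      (Complex.le_def.1 (trace_mul_nonneg (hX _ (hSpos s hs))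
        (weightedJump_posSemidef hc (clickPart_posSemidef hc hρ n hs)))).1
    have hmain := hΛ (Q * S s * Q)
    rw [hinner _ _ (hSpos s hs), hinner _ _ (hSpos s hs), ← trace_mul_tilted hH, ← hcdef,
      Matrix.trace_mul_comm (S s)] at hmain
    rw [mul_one, Matrix.trace_add, hcyc, Complex.add_re, hSe, mul_sub, Matrix.trace_sub,
      Complex.sub_re]
    change _ ≤ 2 * Λ * (Q * S s * Q * S s).trace.re
    linarith
  have hanti : AntitoneOn (fun s => Real.exp (-(2 * Λ) * s) * f s) (Set.Ici 0) := by
    have hd : ∀ s, 0 ≤ s → ∃ g', HasDerivAt (fun s => Real.exp (-(2 * Λ) * s) * f s) g' s ∧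
        g' ≤ 0 := by
      intro s hs
      obtain ⟨f', hf', hle⟩ := hder s hs
      refine ⟨_, (((hasDerivAt_id s).const_mul (-(2 * Λ))).exp).mul hf', ?_⟩
      have := mul_le_mul_of_nonneg_left hle (Real.exp_pos (-(2 * Λ) * s)).le
      simp only [id, mul_one]
      linarith
    refine antitoneOn_of_deriv_nonpos (convex_Ici 0) (fun s hs => ?_) (fun s hs => ?_)
      fun s hs => ?_
    · obtain ⟨g', hg, -⟩ := hd s hs
      exact hg.continuousAt.continuousWithinAt
    · rw [interior_Ici] at hs
      obtain ⟨g', hg, -⟩ := hd s (le_of_lt hs)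
      exact hg.differentiableAt.differentiableWithinAt
    · rw [interior_Ici] at hs
      obtain ⟨g', hg, hg0⟩ := hd s (le_of_lt hs)
      rw [hg.deriv]
      exact hg0
  have hS0 : S 0 = ρ := by
    rw [hS, truncatedState, Finset.sum_range_succ']
    simp [clickPart, noJump_zero]
  have h0 := hanti Set.self_mem_Ici (Set.mem_Ici.2 ht) ht
  have hft : f t ≤ (kmsNorm σ (Q * ρ * Q) * Real.exp (Λ * t)) ^ 2 := by
    have e1 : f 0 = kmsNorm σ (Q * ρ * Q) ^ 2 := by
      rw [hsq _ hρ]; simp only [f, hS0]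
    simp only [mul_zero, Real.exp_zero, one_mul] at h0
    rw [e1] at h0
    have h2 := mul_le_mul_of_nonneg_left h0 (Real.exp_pos (2 * Λ * t)).le
    rw [← mul_assoc, ← Real.exp_add] at h2
    have e2 : 2 * Λ * t + -(2 * Λ) * t = 0 := by ring
    have e3 : Real.exp (2 * Λ * t) = Real.exp (Λ * t) ^ 2 := by
      rw [← Real.exp_nat_mul]; congr 1; push_cast; ring
    rw [e2, Real.exp_zero, one_mul, e3] at h2
    linarith
  have hnorm : kmsNorm σ (Q * S t * Q) ≤ kmsNorm σ (Q * ρ * Q) * Real.exp (Λ * t) := by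
    refine abs_le_of_sq_le_sq' ?_ (mul_nonneg (Real.sqrt_nonneg _) (Real.exp_pos _).le) |>.2
    rw [hsq _ (hSpos t ht)]
    exact hft
  have hone : kmsNorm σ 1 = 1 := by
    rw [kmsNorm, kmsInner_one_left hPd, mul_one, hσ.2]; simp
  have htr : (S t).trace = kmsInner σ (Q * S t * Q) 1 := by
    rw [hinner _ _ (hSpos t ht), mul_one]
  rw [htr]
  refine (Complex.re_le_norm _).trans ((norm_kmsInner_le hPd _ _).trans ?_)
  rwa [hone, mul_one]

end Energy

/-! ### Integration over click times -/

section ClickTimes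

open scoped Matrix.Norms.Operator

/-- The ordered click times in `[0, t]`, as a subset of `ℝ^k`. -/
def orderedTimes (k : ℕ) (t : ℝ) : Set (Fin k → ℝ) :=
  {τ | Monotone τ ∧ ∀ l, τ l ∈ Set.Icc 0 t}

theorem measurableSet_orderedTimes (k : ℕ) (t : ℝ) : MeasurableSet (orderedTimes k t) := by
  refine IsClosed.measurableSet ?_
  have : orderedTimes k t = {τ | Monotone τ} ∩ Set.univ.pi fun _ => Set.Icc 0 t := by
    exact Set.ext fun τ => and_congr Iff.rfl ⟨fun h l _ => h l, fun h l => h l trivial⟩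
  rw [this]
  exact isClosed_monotone.inter (isClosed_set_pi fun _ _ => isClosed_Icc)

theorem snoc_mem_orderedTimes {k : ℕ} {t s : ℝ} {τ : Fin k → ℝ} :
    (Fin.snoc τ s : Fin (k + 1) → ℝ) ∈ orderedTimes (k + 1) t ↔
      s ∈ Set.Icc 0 t ∧ τ ∈ orderedTimes k s := by
  constructor
  · rintro ⟨hmono, hmem⟩
    refine ⟨by simpa using hmem (Fin.last k), fun a b hab => ?_, fun l => ⟨?_, ?_⟩⟩
    · simpa using hmono (Fin.castSucc_le_castSucc_iff.2 hab)
    · simpa using (hmem l.castSucc).1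
    · simpa using hmono (Fin.le_last l.castSucc)
  · rintro ⟨hs, hmono, hmem⟩
    refine ⟨fun a b => ?_, fun l => ?_⟩
    · induction b using Fin.lastCases with
      | last =>
        induction a using Fin.lastCases with
        | last => intro; rfl
        | cast a => intro; simpa using (hmem a).2
      | cast b =>
        induction a using Fin.lastCases with
        | last => intro h; exact absurd h (not_le.2 (Fin.castSucc_lt_last b))
        | cast a => intro h; simpa using hmono (Fin.castSucc_le_castSucc_iff.1 h)
    · induction l using Fin.lastCases with
      | last => simpa using hs
      | cast l => simpa using ⟨(hmem l).1, (hmem l).2.trans hs.2⟩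

variable {d : ℕ} {ι : Type*} [Fintype ι] (H : Mat d) (L : ι → Mat d) (c : ι → ℝ)

/-- The unnormalized state after clicks at the times `τ`, summed over all words with the product of
the weights of their letters; see `weightedTrajectory_eq_sum`. -/
def weightedTrajectory (ρ : Mat d) : (k : ℕ) → (Fin k → ℝ) → ℝ → Mat d
  | 0, _, t => noJump H L t ρ
  | k + 1, τ, t => noJump H L (t - τ (Fin.last k)) (weightedJump L c
      (weightedTrajectory ρ k (fun l => τ l.castSucc) (τ (Fin.last k))))

variable {H L c} {ρ : Mat d}

theorem weightedTrajectory_eq_sum (k : ℕ) (τ : Fin k → ℝ) (t : ℝ) :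
    weightedTrajectory H L c ρ k τ t =
      ∑ w : Fin k → ι, ((∏ l, c (w l) : ℝ) : ℂ) • trajectory H L ρ k w τ t := by
  induction k generalizing t with
  | zero => simp [weightedTrajectory, trajectory]
  | succ k ih =>
    rw [weightedTrajectory, ih, ← (Fin.snocEquiv fun _ => ι).sum_comp, Fintype.sum_prod_type,
      weightedJump_apply, ← noJumpMap_apply, map_sum]
    refine Finset.sum_congr rfl fun j _ => ?_
    rw [map_smul, Finset.mul_sum, Finset.sum_mul, map_sum, Finset.smul_sum]
    refine Finset.sum_congr rfl fun w _ => ?_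
    rw [mul_smul_comm, smul_mul_assoc, map_smul, smul_smul, noJumpMap_apply]
    simp only [Fin.snocEquiv_apply, trajectory, Fin.snoc_last, Fin.snoc_castSucc,
      Fin.prod_univ_castSucc]
    push_cast
    rw [mul_comm (c j : ℂ)]

theorem trajectory_posSemidef (hρ : ρ.PosSemidef) (k : ℕ) (w : Fin k → ι) (τ : Fin k → ℝ)
    (t : ℝ) : (trajectory H L ρ k w τ t).PosSemidef := by
  induction k generalizing t with
  | zero => exact noJump_posSemidef hρ t
  | succ k ih => exact noJump_posSemidef ((ih _ _ _).mul_mul_conjTranspose_same _) _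

theorem continuous_trajectory {X : Type*} [TopologicalSpace X] (k : ℕ) (w : Fin k → ι)
    {τ : X → Fin k → ℝ} {t : X → ℝ} (hτ : Continuous τ) (ht : Continuous t) :
    Continuous fun p => trajectory H L ρ k w (τ p) (t p) := by
  induction k generalizing t with
  | zero => exact continuous_noJump ht continuous_const
  | succ k ih =>
    have hl : Continuous fun p => τ p (Fin.last k) := (continuous_apply _).comp hτ
    have hi : Continuous fun p => fun l : Fin k => τ p l.castSucc :=
      continuous_pi fun l => (continuous_apply _).comp hτ
    exact continuous_noJump (ht.sub hl)
      ((continuous_const.matrix_mul (ih _ hi hl)).matrix_mul continuous_const)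

theorem continuous_weightedTrajectory {X : Type*} [TopologicalSpace X] (k : ℕ)
    {τ : X → Fin k → ℝ} {t : X → ℝ} (hτ : Continuous τ) (ht : Continuous t) :
    Continuous fun p => weightedTrajectory H L c ρ k (τ p) (t p) := by
  simp only [weightedTrajectory_eq_sum]
  exact continuous_finsetSum _ fun w _ =>
    (continuous_trajectory (H := H) (L := L) (ρ := ρ) k w hτ ht).const_smul
      ((∏ l, c (w l) : ℝ) : ℂ)

theorem continuous_re_trace_mul {X : Type*} [TopologicalSpace X] {y : X → Mat d}
    (hy : Continuous y) (x : Mat d) : Continuous fun p => (y p * x).trace.re :=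
  (LinearMap.toContinuousLinearMap (reTraceMul x)).continuous.comp hy

/-- The Heisenberg picture of a jump followed by undisturbed evolution. -/
theorem exists_trace_noJump_weightedJump (hc : ∀ j, 0 ≤ c j) {x : Mat d} (hx : x.PosSemidef)
    (s : ℝ) : ∃ z : Mat d, z.PosSemidef ∧
      ∀ y, (noJump H L s (weightedJump L c y) * x).trace = (y * z).trace := by
  refine ⟨∑ j, (c j : ℂ) • ((L j)ᴴ * ((propagator H L s)ᴴ * x * propagator H L s) * L j),
    Matrix.posSemidef_sum _ fun j _ => ?_, fun y => ?_⟩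
  · exact ((hx.conjTranspose_mul_mul_same _).conjTranspose_mul_mul_same _).smul
      (Complex.zero_le_real.2 (hc j))
  · rw [noJump_eq, Matrix.mul_assoc, Matrix.mul_assoc, Matrix.trace_mul_comm, Matrix.mul_assoc,
      weightedJump_apply, Finset.sum_mul, Finset.mul_sum, Matrix.trace_sum, Matrix.trace_sum]
    refine Finset.sum_congr rfl fun j _ => ?_
    rw [smul_mul_assoc, mul_smul_comm, Matrix.trace_smul, Matrix.trace_smul]
    congr 1
    rw [Matrix.mul_assoc, Matrix.mul_assoc, Matrix.trace_mul_comm (L j)]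
    simp only [Matrix.mul_assoc]

/-- Integrating the last click time out reproduces the recursion that defines `clickPart`. -/
theorem lintegral_weightedTrajectory (hc : ∀ j, 0 ≤ c j) (hρ : ρ.PosSemidef) (k : ℕ) {t : ℝ}
    (ht : 0 ≤ t) {x : Mat d} (hx : x.PosSemidef) :
    ∫⁻ τ in orderedTimes k t, ENNReal.ofReal (weightedTrajectory H L c ρ k τ t * x).trace.re =
      ENNReal.ofReal (clickPart H L c ρ k t * x).trace.re := by
  induction k generalizing t x with
  | zero =>
    have h1 : orderedTimes 0 t = Set.univ := by
      ext τ; simp [orderedTimes, Subsingleton.monotone]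
    rw [h1, Measure.restrict_univ]
    simp only [weightedTrajectory, clickPart, lintegral_const]
    rw [volume_pi, Measure.pi_empty_univ, mul_one]
  | succ k ih =>
    set h : ℝ → ℝ := fun s =>
      (noJump H L (t - s) (weightedJump L c (clickPart H L c ρ k s)) * x).trace.re with hh
    have hmeas : Measurable ((orderedTimes (k + 1) t).indicator fun τ =>
        ENNReal.ofReal (weightedTrajectory H L c ρ (k + 1) τ t * x).trace.re) :=
      (continuous_re_trace_mul (continuous_weightedTrajectory (k + 1) continuous_id
        continuous_const) x).measurable.ennreal_ofReal.indicator (measurableSet_orderedTimes _ _)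
    have hmp := (measurePreserving_piFinSuccAbove
      (fun _ : Fin (k + 1) => (volume : Measure ℝ)) (Fin.last k)).symm
    have hinner : ∀ s : ℝ, ∫⁻ τ : Fin k → ℝ, (orderedTimes (k + 1) t).indicator (fun τ =>
        ENNReal.ofReal (weightedTrajectory H L c ρ (k + 1) τ t * x).trace.re) (Fin.snoc τ s) =
        (Set.Icc 0 t).indicator (fun s => ENNReal.ofReal (h s)) s := by
      intro s
      by_cases hs : s ∈ Set.Icc 0 t
      · obtain ⟨z, hz, hdual⟩ := exists_trace_noJump_weightedJump (H := H) (L := L) hc hx (t - s)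
        rw [Set.indicator_of_mem hs, hh]
        simp only []
        rw [hdual, ← ih hs.1 hz, ← lintegral_indicator (measurableSet_orderedTimes _ _)]
        refine lintegral_congr fun τ => ?_
        by_cases hτ : τ ∈ orderedTimes k s
        · rw [Set.indicator_of_mem hτ, Set.indicator_of_mem (snoc_mem_orderedTimes.2 ⟨hs, hτ⟩),
            ← hdual, weightedTrajectory]
          simp only [Fin.snoc_last, Fin.snoc_castSucc]
        · rw [Set.indicator_of_notMem hτ, Set.indicator_of_notMem fun hmem =>
            hτ (snoc_mem_orderedTimes.1 hmem).2]
      · rw [Set.indicator_of_notMem hs, ← lintegral_zero]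
        refine lintegral_congr fun τ => ?_
        rw [Set.indicator_of_notMem fun hmem => hs (snoc_mem_orderedTimes.1 hmem).1]
    have hcont : Continuous h := by
      refine continuous_re_trace_mul (continuous_noJump (by fun_prop) ?_) x
      exact continuous_weightedJump (continuous_clickPart k)
    have hpos : ∀ s ∈ Set.Icc 0 t, 0 ≤ h s := fun s hs =>
      (Complex.le_def.1 (trace_mul_nonneg (noJump_posSemidef (weightedJump_posSemidef hc
        (clickPart_posSemidef hc hρ k hs.1)) _) hx)).1
    rw [← lintegral_indicator (measurableSet_orderedTimes _ _), volume_pi,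
      ← hmp.lintegral_comp hmeas]
    refine (lintegral_prod _ (hmeas.comp hmp.measurable).aemeasurable).trans ?_
    have hsnoc : ∀ (s : ℝ) (τ : Fin k → ℝ), (MeasurableEquiv.piFinSuccAbove
        (fun _ : Fin (k + 1) => ℝ) (Fin.last k)).symm (s, τ) = Fin.snoc τ s := fun s τ => by
      rw [MeasurableEquiv.piFinSuccAbove_symm_apply]
      simp [Fin.insertNthEquiv]
    simp only [Function.comp_apply, hsnoc]
    refine (lintegral_congr hinner).trans ?_
    rw [lintegral_indicator measurableSet_Icc, ← ofReal_integral_eq_lintegral_ofReal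
      (hcont.integrableOn_Icc) ((ae_restrict_iff' measurableSet_Icc).2
        (Filter.Eventually.of_forall hpos)), integral_Icc_eq_integral_Ioc,
      ← intervalIntegral.integral_of_le ht]
    congr 1
    have hback : Continuous fun s =>
        noJump H L (-s) (weightedJump L c (clickPart H L c ρ k s)) :=
      continuous_noJump continuous_neg (continuous_weightedJump (continuous_clickPart k))
    have hlin := intervalIntegral_linearMap
      ((reTraceMul x) ∘ₗ (noJumpMap H L t).restrictScalars ℝ) hback t
    simp only [LinearMap.comp_apply, LinearMap.restrictScalars_apply, noJumpMap_apply,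
      reTraceMul_apply, noJump_noJump, ← sub_eq_add_neg] at hlin
    exact hlin.symm

end ClickTimes

/-! ### The exponential moment of the number of clicks -/

section Records

open scoped Matrix.Norms.Operator

variable {d : ℕ} {ι : Type*}

theorem measurable_record {t : ℝ} {Y : Type*} [MeasurableSpace Y] {f : Record ι t → Y}
    (hf : ∀ w, Measurable fun τ => f ⟨w, τ⟩) : Measurable f :=
  fun _ hs => MeasurableSpace.measurableSet_iInf.2 fun w => hf w hs

theorem measurable_clickCount [DecidableEq ι] (i : ι) {t : ℝ} :
    Measurable (clickCount i : Record ι t → ℕ) :=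
  measurable_record fun w => by
    change Measurable fun _ => ∑ l, if w.2 l = i then 1 else 0
    exact measurable_const

theorem lintegral_refMeasure {t : ℝ} {g : (w : (k : ℕ) × (Fin k → ι)) → (Fin w.1 → ℝ) → ENNReal}
    (hg : ∀ w, Measurable (g w)) :
    ∫⁻ ω, g ω.1 ω.2.1 ∂refMeasure ι t =
      ∑' (k : ℕ) (w : Fin k → ι), ∫⁻ τ in orderedTimes k t, g ⟨k, w⟩ τ := by
  rw [refMeasure, lintegral_sum_measure, ENNReal.tsum_sigma']
  refine tsum_congr fun k => tsum_congr fun w => ?_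
  have hm : Measurable fun ω : Record ι t => g ω.1 ω.2.1 :=
    measurable_record fun w => (hg w).comp measurable_subtype_coe
  have hmk : Measurable (@Sigma.mk ((k : ℕ) × (Fin k → ι)) (fun w => ClickTimes t w.1) ⟨k, w⟩) :=
    fun s hs => MeasurableSpace.measurableSet_iInf.1 hs ⟨k, w⟩
  rw [lintegral_map hm hmk]
  exact lintegral_subtype_comap (measurableSet_orderedTimes k t) (g ⟨k, w⟩)

theorem exp_mul_clickCount [DecidableEq ι] (i : ι) (u : ℝ) {t : ℝ} (ω : Record ι t) :
    Real.exp (u * clickCount i ω) = ∏ l, tiltWeight i (Real.exp u - 1) (ω.1.2 l) := by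
  rw [clickCount, Nat.cast_sum, Finset.mul_sum, Real.exp_sum]
  refine Finset.prod_congr rfl fun l _ => ?_
  unfold tiltWeight
  split_ifs <;> simp

variable [Fintype ι] {H ρ : Mat d} {L : ι → Mat d} {c : ι → ℝ}

theorem lintegral_weighted_records (hc : ∀ j, 0 ≤ c j) (hρ : ρ.PosSemidef) {t : ℝ} (ht : 0 ≤ t) :
    ∫⁻ ω : Record ι t, ENNReal.ofReal ((∏ l, c (ω.1.2 l)) *
        (trajectory H L ρ ω.1.1 ω.1.2 ω.2.1 t).trace.re) ∂refMeasure ι t =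
      ∑' k : ℕ, ENNReal.ofReal (clickPart H L c ρ k t).trace.re := by
  have hmeas : ∀ w : (k : ℕ) × (Fin k → ι), Measurable fun τ : Fin w.1 → ℝ =>
      ENNReal.ofReal ((∏ l, c (w.2 l)) * (trajectory H L ρ w.1 w.2 τ t).trace.re) := fun w => by
    have h := continuous_re_trace_mul (continuous_trajectory (H := H) (L := L) (ρ := ρ) w.1 w.2
      continuous_id (continuous_const (y := t))) 1
    simp only [mul_one] at h
    exact (h.measurable.const_mul _).ennreal_ofReal
  rw [lintegral_refMeasure (g := fun w τ => ENNReal.ofReal ((∏ l, c (w.2 l)) *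
    (trajectory H L ρ w.1 w.2 τ t).trace.re)) hmeas]
  refine tsum_congr fun k => ?_
  rw [tsum_fintype, ← lintegral_finsetSum _ fun w _ => hmeas ⟨k, w⟩]
  have h := lintegral_weightedTrajectory (H := H) (L := L) hc hρ k ht Matrix.PosSemidef.one
  simp only [mul_one] at h
  rw [← h]
  refine lintegral_congr fun τ => ?_
  rw [← ENNReal.ofReal_sum_of_nonneg]
  · rw [weightedTrajectory_eq_sum, Matrix.trace_sum, Complex.re_sum]
    simp only [Matrix.trace_smul, smul_eq_mul, Complex.re_ofReal_mul]
  · intro w _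
    exact mul_nonneg (Finset.prod_nonneg fun l _ => hc _)
      (Complex.le_def.1 (trajectory_posSemidef hρ k w τ t).trace_nonneg).1

variable [DecidableEq ι]

/-- Chernoff bound for the number of clicks, from a bound `Λ` on the numerical range of the tilted
generator. -/
theorem recordLaw_clickCount_ge_le {σ : Mat d} (hH : H.IsHermitian) (hσ : IsFaithfulState σ)
    (i : ι) {u Λ : ℝ} (hu : 0 ≤ u)
    (hΛ : ∀ x, (kmsInner σ x (gkls H L x + ((Real.exp u - 1 : ℝ) : ℂ) • jumpMap (L i) x)).re ≤
      Λ * (kmsInner σ x x).re)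
    (hρ : ρ.PosSemidef) {t : ℝ} (ht : 0 ≤ t) (a : ℝ) :
    recordLaw H L ρ t {ω | a ≤ (clickCount i ω : ℝ)} ≤
      ENNReal.ofReal (kmsNorm σ (mpow σ (-(1 / 2)) * ρ * mpow σ (-(1 / 2))) *
        Real.exp (Λ * t - u * a)) := by
  have hr : 0 ≤ Real.exp u - 1 := by linarith [Real.add_one_le_exp u]
  set c := tiltWeight i (Real.exp u - 1) with hcdef
  have hc : ∀ j, 0 ≤ c j := tiltWeight_nonneg i hr
  have hset : MeasurableSet {ω : Record ι t | a ≤ (clickCount i ω : ℝ)} :=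
    measurableSet_le measurable_const
      ((measurable_from_top (f := (Nat.cast : ℕ → ℝ))).comp (measurable_clickCount i))
  set N := kmsNorm σ (mpow σ (-(1 / 2)) * ρ * mpow σ (-(1 / 2)))
  have hmoment : ∑' k : ℕ, ENNReal.ofReal (clickPart H L c ρ k t).trace.re ≤
      ENNReal.ofReal (N * Real.exp (Λ * t)) := by
    refine ENNReal.tsum_le_of_sum_range_le fun n => ?_
    refine (Finset.sum_le_sum_of_subset (Finset.range_subset_range.2 n.le_succ)).trans ?_
    rw [← ENNReal.ofReal_sum_of_nonneg fun k _ =>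
      (Complex.le_def.1 (clickPart_posSemidef hc hρ k ht).trace_nonneg).1]
    refine ENNReal.ofReal_le_ofReal ?_
    have := trace_truncatedState_le hH hσ i hr hΛ hρ n ht
    rwa [truncatedState, Matrix.trace_sum, Complex.re_sum] at this
  rw [recordLaw, withDensity_apply _ hset, ← lintegral_indicator hset]
  calc ∫⁻ ω, {ω : Record ι t | a ≤ (clickCount i ω : ℝ)}.indicator (fun ω =>
        ENNReal.ofReal (trajectory H L ρ ω.1.1 ω.1.2 ω.2.1 t).trace.re) ω ∂refMeasure ι t
      ≤ ∫⁻ ω, ENNReal.ofReal (Real.exp (-(u * a))) * ENNReal.ofReal ((∏ l, c (ω.1.2 l)) *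
        (trajectory H L ρ ω.1.1 ω.1.2 ω.2.1 t).trace.re) ∂refMeasure ι t := by
        refine lintegral_mono fun ω => ?_
        by_cases hω : ω ∈ {ω : Record ι t | a ≤ (clickCount i ω : ℝ)}
        · rw [Set.indicator_of_mem hω, ← ENNReal.ofReal_mul (Real.exp_pos _).le]
          refine ENNReal.ofReal_le_ofReal ?_
          rw [← exp_mul_clickCount, ← mul_assoc, ← Real.exp_add]
          refine le_mul_of_one_le_left
            (Complex.le_def.1 (trajectory_posSemidef hρ _ _ _ t).trace_nonneg).1
            (Real.one_le_exp ?_)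
          have := mul_le_mul_of_nonneg_left (show a ≤ _ from hω) hu
          linarith
        · rw [Set.indicator_of_notMem hω]
          exact zero_le
    _ = ENNReal.ofReal (Real.exp (-(u * a))) *
        ∑' k : ℕ, ENNReal.ofReal (clickPart H L c ρ k t).trace.re := by
        rw [lintegral_const_mul' _ _ ENNReal.ofReal_ne_top, lintegral_weighted_records hc hρ ht]
    _ ≤ ENNReal.ofReal (Real.exp (-(u * a))) * ENNReal.ofReal (N * Real.exp (Λ * t)) := by
        gcongr
    _ = ENNReal.ofReal (N * Real.exp (Λ * t - u * a)) := by
        rw [← ENNReal.ofReal_mul (Real.exp_pos _).le, sub_eq_add_neg, Real.exp_add]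
        congr 1
        ring

end Records

end QuantumCounting

end

/-! ### The tail bound -/

open QuantumCounting
theorem theorem4p1 {d : ℕ} {ι : Type*} [Fintype ι] [DecidableEq ι]
    (H : Mat d) (hH : H.IsHermitian) (L : ι → Mat d)
    (σ : Mat d) (hσ : IsUniqueFaithfulInvariantState (gkls H L) σ)
    (i : ι) (A B : Mat d →ₗ[ℂ] Mat d)
    (hA : A = kmsRe σ (gkls H L)) (hB : B = kmsRe σ (jumpMap (L i)))
    (hirr : GeneratesIrreducibleQMS A)
    (m α b ε : ℝ)
    (hm : m = ((L i)ᴴ * L i * σ).trace.re)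
    (hα : α = kmsOpNorm σ B)
    (hb : b = kmsNorm σ (B 1))
    (hε : ε = spectralGap A)
    (ρ : Mat d) (hρ : IsState ρ)
    (t γ : ℝ) (ht : 0 ≤ t) (hγ : 0 < γ) :
    recordLaw H L ρ t {ω | (clickCount i ω : ℝ) / t - m ≥ γ} ≤
      ENNReal.ofReal
        (kmsNorm σ (mpow σ (-(1 / 2)) * ρ * mpow σ (-(1 / 2))) *
          Real.exp (-(t * (γ ^ 2 /
            (2 * (m + 2 * b ^ 2 / ε + max (5 * α / ε) (5 / 2) * γ)))))) := by
  subst hA hB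
  have hm0 : 0 ≤ m := by
    rw [hm]
    exact (Complex.le_def.1 (trace_mul_nonneg
      (Matrix.posSemidef_conjTranspose_mul_self (L i)) hσ.1.1.posSemidef)).1
  rcases ht.eq_or_lt with rfl | ht0
  · -- at `t = 0` the event reads `-m ≥ γ`
    have hempty : {ω : Record ι 0 | (clickCount i ω : ℝ) / 0 - m ≥ γ} = ∅ := by
      refine Set.eq_empty_of_forall_notMem fun ω hω => ?_
      have hω : γ ≤ (clickCount i ω : ℝ) / 0 - m := hω
      rw [div_zero] at hω
      linarith
    rw [hempty, measure_empty]
    exact zero_le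
  have hα0 : 0 ≤ α := hα ▸ kmsOpNorm_nonneg _
  have hε0 : 0 ≤ ε := hε ▸ Real.sInf_nonneg fun l hl => hl.1.le
  obtain ⟨u, δ, hu, hδ, hcond, hrate⟩ := exists_tilt (b := b) hm0 hα0 hε0 hγ
  have hr : 0 ≤ Real.exp u - 1 := by linarith [Real.add_one_le_exp u]
  have hΛ := re_kmsInner_tilted_le hH hσ.1 hσ.2.1 hirr i hm hα hb hε hr hδ hcond
  have hset : {ω : Record ι t | (clickCount i ω : ℝ) / t - m ≥ γ} =
      {ω | t * (m + γ) ≤ (clickCount i ω : ℝ)} := by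
    refine Set.ext fun ω => ?_
    change γ ≤ (clickCount i ω : ℝ) / t - m ↔ t * (m + γ) ≤ (clickCount i ω : ℝ)
    rw [le_sub_iff_add_le, le_div_iff₀ ht0, add_comm γ, mul_comm t]
  rw [hset]
  refine (recordLaw_clickCount_ge_le hH hσ.1 i hu hΛ hρ.1 ht (t * (m + γ))).trans
    (ENNReal.ofReal_le_ofReal (mul_le_mul_of_nonneg_left (Real.exp_le_exp.2 ?_)
      (Real.sqrt_nonneg _)))
  have := mul_le_mul_of_nonneg_left hrate ht
  linarith
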